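/- Notation. For $f,g\in\mathbb{C}[x,y]$ let $[f,g]=f_xg_y-f_yg_x$. Let $N^0(f)\subseteq\mathbb{R}^2$ be the convex hull of $(0,0)$ and all $(i,j)$ such that $x^iy^j$ occurs in $f$ with nonzero coefficient. Let $\operatorname{Rect}_{m,n}$ be the convex hull of $(0,0),(m,0),(m,n),(0,n)$, and let $R_{m,n}$ be the set of $f\in\mathbb{C}[x,y]$ with $N^0(f)=\operatorname{Rect}_{m,n}$ in which $x^my^n$ has coefficient $1$. Let $\mathbb{T}$ be the set of monic polynomials $z^k+e_{k-1}z^{k-1}+\cdots+e_0\in\mathbb{C}[z]$ with $k\ge 1$ and $e_{k-1}=0$. A polynomial $W\in\mathbb{C}[x,y]$ is called principal if $W=\alpha(V)$ with $\alpha\in\mathbb{T}$, $V\in\mathbb{C}[x,y]$ implies $V=W$. The NE vertex of a convex polygon is the rightmost one of its uppermost vertices; its EN vertex is the uppermost one of its rightmost vertices. Let $a,b,m,n$ be positive integers with $2\le a<b$, $\gcd(a,b)=1$, $a\mid m$, $a\mid n$ and $m\le n$. Let $F\in R_{m,n}$ and $G\in R_{bm/a,bn/a}$ with $[F,G]\in\mathbb{C}$,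 so that $b/a=\deg G/\deg F$. Let $\mathcal{N}''=\operatorname{Rect}_{m/a,n/a}+\frac{a-1}{a}(m,n)$. - The pre-generator of $F$ is the polynomial $Q\in R_{m/a,n/a}$ with $\operatorname{supp}(F-Q^a)\subseteq N^0(F)\setminus\mathcal{N}''$; the inner polynomial of $F$ is $\zeta(F)=F-Q^a$. - The generator of $F$ is the principal polynomial $W_F$ for which there are a common divisor $\delta\geq 1$ of $m/a$ and $n/a$ and a $\beta\in\mathbb{T}$ of degree $\delta$ with $W_F\in R_{m/(a\delta),n/(a\delta)}$ and $\operatorname{supp}(F-\beta(W_F)^a)\subseteq N^0(F)\setminus\mathcal{N}''$. - The innermost polynomial of $F$ is $Z=F-Q^a-\sum_{j=0}^{(a-1)\delta-1}e_jW_F^j$, where the $e_j\in\mathbb{C}$ are such that none of the monomials $x^{jm/(a\delta)}y^{jn/(a\delta)}$, $0\le j\le(a-1)\delta-1$, occurs in $Z$. Theorem. Assume $\dfrac{b}{a}>\dfrac{n-m}{a}-1$. Then polynomials $Z$ and $\zeta(F)$ as above exist, and for $f=Z$ as well as for $f=\zeta(F)$ the following holds: the NE vertex $(m',n')$ of $N^0(f)$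 coincides with its EN vertex, it lies on the line $y=\frac{n}{m}x$, and $N^0(f)\subseteq\operatorname{Rect}_{m',n'}$. -/

import Mathlib

namespace JacobianPlane

noncomputable section

/-- The polynomial ring `ℂ[x, y]`, with `x = X 0` and `y = X 1`. -/
abbrev Poly : Type := MvPolynomial (Fin 2) ℂ

/-- The Jacobian determinant `[f, g]`. -/
def jac (f g : Poly) : Poly :=
  Matrix.det !![MvPolynomial.pderiv 0 f, MvPolynomial.pderiv 0 g;
                MvPolynomial.pderiv 1 f, MvPolynomial.pderiv 1 g]

/-- The exponent of the monomial `x ^ i * y ^ j`. -/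
def expo (i j : ℕ) : Fin 2 →₀ ℕ := Finsupp.single 0 i + Finsupp.single 1 j

/-- The coefficient of `x ^ i * y ^ j` in `f`. -/
def coeffXY (i j : ℕ) (f : Poly) : ℂ := MvPolynomial.coeff (expo i j) f

/-- The support of `f`, as a set of points of the plane. -/
def supp (f : Poly) : Set (ℝ × ℝ) :=
  {p | ∃ i j : ℕ, coeffXY i j f ≠ 0 ∧ p = ((i : ℝ), (j : ℝ))}

/-- The augmented Newton polygon `N⁰(f)`: the convex hull of the support of `f` and the origin. -/
def augNewton (f : Poly) : Set (ℝ × ℝ) := convexHull ℝ (supp f ∪ {(0, 0)})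

/-- The rectangle with vertices `(0,0), (m,0), (m,n), (0,n)`. -/
def rect (m n : ℕ) : Set (ℝ × ℝ) :=
  convexHull ℝ {((0 : ℝ), (0 : ℝ)), ((m : ℝ), (0 : ℝ)), ((m : ℝ), (n : ℝ)), ((0 : ℝ), (n : ℝ))}

/-- The set `R_{m,n}`: polynomials `f` with `N⁰(f)` equal to the rectangle `rect m n` and with
coefficient `1` at `x ^ m * y ^ n`. -/
def rectPoly (m n : ℕ) : Set Poly :=
  {f | augNewton f = rect m n ∧ coeffXY m n f = 1}

/-- Tschirnhausen polynomials: monic polynomials `z ^ k + e_{k-1} z ^ (k-1) + ⋯ + e_0` of degree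
`k > 0` with `e_{k-1} = 0`. -/
def tschirnhausen : Set (Polynomial ℂ) :=
  {α | α.Monic ∧ 0 < α.natDegree ∧ α.coeff (α.natDegree - 1) = 0}

/-- The set of all `W` such that `f = α(W)` for some Tschirnhausen polynomial `α`. -/
def decomps (f : Poly) : Set Poly :=
  {W | ∃ α ∈ tschirnhausen, f = Polynomial.aeval W α}

/-- A polynomial `f` is principal if `f` itself is the only element of `decomps f`. -/
def IsPrincipalPoly (f : Poly) : Prop := decomps f = {f}

/-- The rectangle `rect (m / a) (n / a)` translated by `((a - 1) / a) • (m, n)`; it is the copy of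
`rect (m / a) (n / a)` in the upper right corner of `rect m n`. -/
def cornerRect (a m n : ℕ) : Set (ℝ × ℝ) :=
  (fun p : ℝ × ℝ => p + (((a : ℝ) - 1) / a) • ((m : ℝ), (n : ℝ))) '' rect (m / a) (n / a)

/-- `Q` is the pre-generator of the pair `(F, a)`. -/
structure IsPreGenerator (a m n : ℕ) (F Q : Poly) : Prop where
  mem : Q ∈ rectPoly (m / a) (n / a)
  supp_subset : supp (F - Q ^ a) ⊆ augNewton F \ cornerRect a m n

/-- `ζ = F - Q ^ a`, with `Q` the pre-generator, is the inner polynomial of the pair `(F, a)`. -/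
def IsInnerPolynomial (a m n : ℕ) (F ζ : Poly) : Prop :=
  ∃ Q, IsPreGenerator a m n F Q ∧ ζ = F - Q ^ a

/-- `W` is the `F`-generator, `β` is the accompanying Tschirnhausen polynomial and `δ` is the
degree of `β`. -/
structure IsGenerator (a m n : ℕ) (F : Poly) (δ : ℕ) (β : Polynomial ℂ) (W : Poly) : Prop where
  tsch : β ∈ tschirnhausen
  natDegree_eq : β.natDegree = δ
  principal : IsPrincipalPoly W
  dvd_left : δ ∣ m / a
  dvd_right : δ ∣ n / a
  mem : W ∈ rectPoly (m / (a * δ)) (n / (a * δ))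
  supp_subset : supp (F - (Polynomial.aeval W β) ^ a) ⊆ augNewton F \ cornerRect a m n

/-- `Z` is the innermost polynomial of `F`: with `Q` the pre-generator and `W` the `F`-generator,
`Z = F - Q ^ a - ∑ e_j W ^ j`, the sum being over `0 ≤ j ≤ (a - 1) δ - 1`, where the constants
`e_j` are such that no monomial `x ^ (j m / (a δ)) * y ^ (j n / (a δ))` with `j` in that range
occurs in `Z`. -/
def IsInnermostPolynomial (a m n : ℕ) (F Z : Poly) : Prop :=
  ∃ (Q : Poly) (δ : ℕ) (β : Polynomial ℂ) (W : Poly) (e : ℕ → ℂ),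
    IsPreGenerator a m n F Q ∧ IsGenerator a m n F δ β W ∧
    Z = F - Q ^ a - ∑ j ∈ Finset.range ((a - 1) * δ), MvPolynomial.C (e j) * W ^ j ∧
    ∀ j ∈ Finset.range ((a - 1) * δ), coeffXY (j * m / (a * δ)) (j * n / (a * δ)) Z = 0

/-- `v` is the NE vertex of the polygon `P`: among the uppermost vertices the rightmost one. -/
def IsNEVertex (P : Set (ℝ × ℝ)) (v : ℝ × ℝ) : Prop :=
  v ∈ P.extremePoints ℝ ∧ ∀ p ∈ P.extremePoints ℝ, p.2 < v.2 ∨ (p.2 = v.2 ∧ p.1 ≤ v.1)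

/-- `v` is the EN vertex of the polygon `P`: among the rightmost vertices the uppermost one. -/
def IsENVertex (P : Set (ℝ × ℝ)) (v : ℝ × ℝ) : Prop :=
  v ∈ P.extremePoints ℝ ∧ ∀ p ∈ P.extremePoints ℝ, p.1 < v.1 ∨ (p.1 = v.1 ∧ p.2 ≤ v.2)

/-- The conclusion of the inner (innermost) vertex conjecture for a polynomial `f`: the NE vertex
`(m', n')` of `N⁰(f)` coincides with its EN vertex, lies on the line `y = (n / m) x`, and `N⁰(f)`
is contained in `rect m' n'`. -/
def VertexProperty (m n : ℕ) (f : Poly) : Prop :=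
  ∃ m' n' : ℕ, IsNEVertex (augNewton f) ((m' : ℝ), (n' : ℝ)) ∧
    IsENVertex (augNewton f) ((m' : ℝ), (n' : ℝ)) ∧
    (n' : ℝ) = (n : ℝ) / m * m' ∧
    augNewton f ⊆ rect m' n'

end

end JacobianPlane

/-!
Let `F = α(W) + Z` with `α` monic of degree `aδ`. For the inner polynomial, `W` is the pre-generator,
`α = z ^ a` and `δ = 1`; for the innermost polynomial, `W` is the generator and
`α = β ^ a + ∑ e_j z ^ j`. Let `(V, ν)` be the upper end of the right edge of the Newton polygon of
`Z`. It is enough to show that this point is not below the diagonal of the rectangle, and that the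
right end of the upper edge is not above it: then both are the same point, it lies on the diagonal,
and the polygon is contained in the rectangle below it (`vertexProperty_of_jac`). The second claim
is the first one with `x` and `y` exchanged.

Suppose that `(V, ν)` is below the diagonal (`EN_le_diagonal`). In a neighbourhood of `x = ∞`, with
`u = y`, the polynomials `W`, `G`, `Z` are elements of `ℂ[u][x, x⁻¹]` with top coefficients `ω`, `ψ`,
`ζ`, and the Jacobian determinant, in the coordinates `(log x, u)`, is a constant multiple of a power
`x ^ ε` whose degree is less than the sum of the degrees of `F` and `G`. Hence the top coefficients
of `F` and `G` have vanishing bracket and are, up to constants, powers `f ^ a`, `f ^ b` of one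
polynomial (`exists_common_root_of_derivative_eq`). The degree of `ζ` being small, `Z` cannot
contribute to the top coefficient of `F`, and `ψ` is proportional to `ω ^ (bδ)`
(`BranchState.rigid`). Now move a root of `ω` to `u = 0` and substitute `u ↦ x ^ (-s) u`, where `s`
is the slope of the next edge of the Newton polygons; a root of `x` is extracted to remain in
`ℂ[u][x, x⁻¹]`. This gives the same picture with a smaller multiplicity `K` of the root or, for
constant `K`, with a smaller degree `w` of `W`, so the process cannot go on forever
(`BranchCorner.false`).

What has to be carried along is that `Z` stays below the ray through the vertex of `W`. The condition
`Unbalanced` bounds the distance to that ray from below in terms of `K`, `w` and `ε`. It is invariant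
under the substitutions. The distance is additive over the roots and the bound is superadditive, so
one of the roots inherits the condition (`Unbalanced.exists_of_sum`). At the start it follows from `b / a > (n - m) / a - 1`; after the
exchange of `x` and `y` it holds automatically because `m ≤ n`.

For the existence of `Q`, the coefficients of an approximate `a`-th root of `F` at the upper right
corner are determined one after the other (`exists_pow_offCorner`). That its Newton polygon is the
full rectangle is again due to the vanishing bracket: the outer edges of `F` carry exact `a`-th
powers (`coeffXY_zero_ne_zero_of_offCorner`). The generator is the `W` in a decomposition
`Q = β(W)` with `β` of maximal degree (`exists_principal`).
-/

namespace JacobianPlane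

open scoped Polynomial

/-! ### Powers of univariate polynomials -/

/-- Comparing the lowest order terms at `x` of both sides of a logarithmic differential equation. -/
theorem mul_rootMultiplicity_eq {a b : ℕ} {p q : ℂ[X]} (hp : p ≠ 0) (hq : q ≠ 0)
    (h : (a : ℂ[X]) * (p * q.derivative) = b * (p.derivative * q)) (x : ℂ) :
    a * q.rootMultiplicity x = b * p.rootMultiplicity x := by
  obtain ⟨p0, hp0, hpx⟩ := Polynomial.exists_eq_pow_rootMultiplicity_mul_and_not_dvd p hp x
  obtain ⟨q0, hq0, hqx⟩ := Polynomial.exists_eq_pow_rootMultiplicity_mul_and_not_dvd q hq x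
  rw [Polynomial.dvd_iff_isRoot, Polynomial.IsRoot] at hpx hqx
  generalize p.rootMultiplicity x = i at *
  generalize q.rootMultiplicity x = j at *
  have key : ∀ (k : ℕ) (r : ℂ[X]), (Polynomial.X - Polynomial.C x) *
      Polynomial.derivative ((Polynomial.X - Polynomial.C x) ^ k * r) =
      (Polynomial.X - Polynomial.C x) ^ k *
        ((k : ℂ[X]) * r + (Polynomial.X - Polynomial.C x) * r.derivative) := by
    intro k r
    rcases k with _ | k
    · simp
    · simp only [Polynomial.derivative_mul, Polynomial.derivative_X_sub_C_pow]
      push_cast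
      simp only [map_add, map_natCast, map_one]
      ring
  have h2 : (Polynomial.X - Polynomial.C x) ^ (i + j) * ((a : ℂ[X]) *
      (p0 * ((j : ℂ[X]) * q0 + (Polynomial.X - Polynomial.C x) * q0.derivative))) =
      (Polynomial.X - Polynomial.C x) ^ (i + j) * ((b : ℂ[X]) *
      (((i : ℂ[X]) * p0 + (Polynomial.X - Polynomial.C x) * p0.derivative) * q0)) := by
    have e1 := key i p0
    have e2 := key j q0
    rw [← hp0] at e1
    rw [← hq0] at e2
    have h3 := congrArg (fun r => (Polynomial.X - Polynomial.C x) * r) h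
    beta_reduce at h3
    calc _ = (a : ℂ[X]) * (((Polynomial.X - Polynomial.C x) ^ i * p0) *
          ((Polynomial.X - Polynomial.C x) ^ j *
            ((j : ℂ[X]) * q0 + (Polynomial.X - Polynomial.C x) * q0.derivative))) := by ring
      _ = (a : ℂ[X]) * (p * ((Polynomial.X - Polynomial.C x) * q.derivative)) := by
          rw [e2, ← hp0]
      _ = (b : ℂ[X]) * (((Polynomial.X - Polynomial.C x) * p.derivative) * q) := by
          linear_combination h3
      _ = _ := by rw [e1]; nth_rewrite 1 [hq0]; ring
  have h3 := mul_left_cancel₀ (pow_ne_zero _ (Polynomial.X_sub_C_ne_zero x)) h2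
  have h4 := congrArg (Polynomial.eval x) h3
  simp only [Polynomial.eval_mul, Polynomial.eval_add, Polynomial.eval_natCast,
    Polynomial.eval_sub, Polynomial.eval_X, Polynomial.eval_C, sub_self, zero_mul, add_zero] at h4
  have h5 : ((a * j : ℕ) : ℂ) = ((b * i : ℕ) : ℂ) := by
    push_cast
    have : Polynomial.eval x p0 * Polynomial.eval x q0 ≠ 0 := mul_ne_zero hpx hqx
    apply mul_right_cancel₀ this
    linear_combination h4
  exact_mod_cast h5

/-- A nonzero complex polynomial is determined, up to a constant, by the multiplicities of its
roots. -/
theorem eq_C_mul_prod_of_rootMultiplicity {p : ℂ[X]} (S : Finset ℂ) (k : ℂ → ℕ)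
    (hS : ∀ x, x ∉ S → p.rootMultiplicity x = 0) (hk : ∀ x, p.rootMultiplicity x = k x) :
    p = Polynomial.C p.leadingCoeff * ∏ x ∈ S, (Polynomial.X - Polynomial.C x) ^ k x := by
  conv_lhs => rw [(IsAlgClosed.splits p).eq_prod_roots]
  congr 1
  rw [Finset.prod_multiset_map_count]
  have hsub : p.roots.toFinset ⊆ S := by
    intro x hx
    by_contra hn
    have := hS x hn
    rw [← Polynomial.count_roots, Multiset.count_eq_zero] at this
    exact this (Multiset.mem_toFinset.1 hx)
  rw [← Finset.prod_subset hsub]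
  · refine Finset.prod_congr rfl fun x _ => ?_
    rw [Polynomial.count_roots, hk]
  · intro x _ hx
    rw [← hk, ← Polynomial.count_roots, Multiset.count_eq_zero.2, pow_zero]
    exact fun h => hx (Multiset.mem_toFinset.2 h)

/-- The solutions of `a p q' = b p' q` with `a`, `b` coprime are, up to constants, the powers
`p = f ^ a` and `q = f ^ b` of a common polynomial. -/
theorem exists_common_root_of_derivative_eq {a b : ℕ} (ha : 0 < a) (hab : Nat.Coprime a b)
    {p q : ℂ[X]} (hp : p ≠ 0) (hq : q ≠ 0)
    (h : (a : ℂ[X]) * (p * q.derivative) = b * (p.derivative * q)) :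
    ∃ (f : ℂ[X]) (c : ℂ), c ≠ 0 ∧ p = f ^ a ∧ q = Polynomial.C c * f ^ b := by
  have hm := mul_rootMultiplicity_eq hp hq h
  have hdvd : ∀ x, a ∣ p.rootMultiplicity x := fun x =>
    hab.dvd_of_dvd_mul_left ⟨_, (hm x).symm⟩
  set k : ℂ → ℕ := fun x => p.rootMultiplicity x / a with hk
  have hka : ∀ x, p.rootMultiplicity x = k x * a := fun x => (Nat.div_mul_cancel (hdvd x)).symm
  have hkb : ∀ x, q.rootMultiplicity x = k x * b := by
    intro x
    have := hm x
    rw [hka] at this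
    apply Nat.eq_of_mul_eq_mul_left ha
    rw [this]; ring
  have hS : ∀ x, x ∉ p.roots.toFinset → p.rootMultiplicity x = 0 := by
    intro x hx
    rw [← Polynomial.count_roots, Multiset.count_eq_zero]
    exact fun h => hx (Multiset.mem_toFinset.2 h)
  have hS' : ∀ x, x ∉ p.roots.toFinset → q.rootMultiplicity x = 0 := by
    intro x hx
    have h0 := hS x hx
    rw [hka] at h0
    rw [hkb]
    rcases Nat.mul_eq_zero.1 h0 with h | h
    · rw [h, zero_mul]
    · omega
  have e1 := eq_C_mul_prod_of_rootMultiplicity _ _ hS hka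
  have e2 := eq_C_mul_prod_of_rootMultiplicity _ _ hS' hkb
  obtain ⟨c, hc⟩ := IsAlgClosed.exists_pow_nat_eq p.leadingCoeff ha
  have hlp : p.leadingCoeff ≠ 0 := Polynomial.leadingCoeff_ne_zero.2 hp
  have hlq : q.leadingCoeff ≠ 0 := Polynomial.leadingCoeff_ne_zero.2 hq
  have hc0 : c ≠ 0 := by
    rintro rfl
    rw [zero_pow ha.ne'] at hc
    exact hlp hc.symm
  refine ⟨Polynomial.C c * ∏ x ∈ p.roots.toFinset, (Polynomial.X - Polynomial.C x) ^ k x,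
    q.leadingCoeff / c ^ b, div_ne_zero hlq (pow_ne_zero _ hc0), ?_, ?_⟩
  · rw [mul_pow, ← Polynomial.C_pow, hc, ← Finset.prod_pow]
    simpa only [← pow_mul] using e1
  · rw [mul_pow, ← Polynomial.C_pow, ← mul_assoc, ← Polynomial.C_mul,
      div_mul_cancel₀ _ (pow_ne_zero _ hc0), ← Finset.prod_pow]
    simpa only [← pow_mul] using e2

/-- The coefficient of the complete homogeneous sum of two polynomials with the same degree and
leading coefficient does not cancel. -/
theorem coeff_geom_sum₂ {f g : ℂ[X]} {k : ℕ} (a : ℕ) (hf : f.natDegree ≤ k) (hg : g.natDegree ≤ k)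
    (hfg : f.coeff k = g.coeff k) :
    (∑ i ∈ Finset.range a, f ^ i * g ^ (a - 1 - i)).coeff ((a - 1) * k) =
      a * g.coeff k ^ (a - 1) := by
  rw [Polynomial.finsetSum_coeff]
  rw [Finset.sum_congr rfl (g := fun _ => g.coeff k ^ (a - 1))]
  · simp
  · intro i hi
    have hi' : i + (a - 1 - i) = a - 1 := by have := Finset.mem_range.1 hi; omega
    have h1 : (a - 1) * k = i * k + (a - 1 - i) * k := by rw [← add_mul, hi']
    rw [h1, Polynomial.coeff_mul_add_eq_of_natDegree_le (Polynomial.natDegree_pow_le_of_le _ hf)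
      (Polynomial.natDegree_pow_le_of_le _ hg), Polynomial.coeff_pow_of_natDegree_le hf,
      Polynomial.coeff_pow_of_natDegree_le hg, hfg, ← pow_add, hi']

/-- Two `a`-th powers of degree `a k` whose difference has degree less than `(a - 1) k` coincide.
Once `g` has been multiplied by a root of unity so that its leading coefficient is that of `f`, the
cofactor of `f - g` in `f ^ a - g ^ a` has degree exactly `(a - 1) k`. -/
theorem eq_C_mul_of_natDegree_pow_sub_lt {a : ℕ} (ha : 0 < a) {f g : ℂ[X]} (hg : g ≠ 0)
    (h : (f ^ a - g ^ a).natDegree < (a - 1) * g.natDegree) :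
    ∃ c : ℂ, c ^ a = 1 ∧ f = Polynomial.C c * g := by
  set k := g.natDegree with hk
  have hga : (g ^ a).natDegree = a * k := Polynomial.natDegree_pow _ _
  have hdeg : (f ^ a).natDegree = (g ^ a).natDegree ∧ (f ^ a).leadingCoeff = (g ^ a).leadingCoeff := by
    have hlt : (f ^ a - g ^ a).degree < (g ^ a).degree := by
      apply Polynomial.degree_lt_degree
      rw [hga]
      exact h.trans_le (Nat.mul_le_mul_right _ (Nat.sub_le _ _))
    have e : f ^ a = g ^ a + (f ^ a - g ^ a) := by ring
    rw [e]
    exact ⟨Polynomial.natDegree_add_eq_left_of_degree_lt hlt,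
      Polynomial.leadingCoeff_add_of_degree_lt' hlt⟩
  have hfk : f.natDegree = k := by
    have := hdeg.1
    rw [Polynomial.natDegree_pow, Polynomial.natDegree_pow] at this
    exact Nat.eq_of_mul_eq_mul_left ha this
  have hlc := hdeg.2
  rw [Polynomial.leadingCoeff_pow, Polynomial.leadingCoeff_pow] at hlc
  have hlg : g.leadingCoeff ≠ 0 := Polynomial.leadingCoeff_ne_zero.2 hg
  set c := f.leadingCoeff / g.leadingCoeff with hc
  have hca : c ^ a = 1 := by
    rw [hc, div_pow, hlc, div_self (pow_ne_zero _ hlg)]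
  refine ⟨c, hca, ?_⟩
  set g' := Polynomial.C c * g with hg'
  have hg'a : g' ^ a = g ^ a := by
    rw [hg', mul_pow, ← Polynomial.C_pow, hca, Polynomial.C_1, one_mul]
  have hc0 : c ≠ 0 := by rintro h0; rw [h0, zero_pow ha.ne'] at hca; exact zero_ne_one hca
  have hg'k : g'.natDegree ≤ k := by
    rw [hg', Polynomial.natDegree_C_mul hc0]
  have hcoef : f.coeff k = g'.coeff k := by
    rw [hg', Polynomial.coeff_C_mul, ← hfk]
    rw [Polynomial.coeff_natDegree, hfk, hk, Polynomial.coeff_natDegree, hc,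
      div_mul_cancel₀ _ hlg]
  have hcoef0 : g'.coeff k ≠ 0 := by
    rw [hg', Polynomial.coeff_C_mul]
    exact mul_ne_zero hc0 (by rw [hk, Polynomial.coeff_natDegree]; exact hlg)
  by_contra hne
  have hS := coeff_geom_sum₂ a hfk.le hg'k hcoef
  set S := ∑ i ∈ Finset.range a, f ^ i * g' ^ (a - 1 - i) with hSdef
  have hS0 : S.coeff ((a - 1) * k) ≠ 0 := by
    rw [hS]
    exact mul_ne_zero (by exact_mod_cast ha.ne') (pow_ne_zero _ hcoef0)
  have hSne : S ≠ 0 := by rintro h0; rw [h0] at hS0; simp at hS0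
  have hprod : S * (f - g') = f ^ a - g ^ a := by
    rw [hSdef, Commute.geom_sum₂_mul (Commute.all _ _), hg'a]
  have h1 := Polynomial.natDegree_mul hSne (sub_ne_zero.2 hne)
  rw [hprod] at h1
  have h2 := Polynomial.le_natDegree_of_ne_zero hS0
  omega

/-! ### Laurent polynomials in `x` with coefficients in `ℂ[u]` -/

/-- The ring `ℂ[u][x, x⁻¹]`, in which the local coordinates at infinity live: `x` is large and `u`
is the second coordinate. -/
abbrev LPoly : Type := LaurentPolynomial ℂ[X]

/-- `A = p(u) x ^ M + (lower powers of x)`. The polynomial `p` is allowed to vanish. -/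
def HasTop (A : LPoly) (M : ℤ) (p : ℂ[X]) : Prop :=
  (∀ i, M < i → A.coeff i = 0) ∧ A.coeff M = p

namespace HasTop

variable {A B : LPoly} {M N : ℤ} {p q : ℂ[X]}

theorem of_lt (h : HasTop A M p) (hMN : M < N) : HasTop A N 0 :=
  ⟨fun i hi => h.1 i (hMN.trans hi), h.1 N hMN⟩

theorem add (hA : HasTop A M p) (hB : HasTop B M q) : HasTop (A + B) M (p + q) := by
  refine ⟨fun i hi => ?_, ?_⟩
  · simp [hA.1 i hi, hB.1 i hi]
  · simp [hA.2, hB.2]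

theorem sub (hA : HasTop A M p) (hB : HasTop B M q) : HasTop (A - B) M (p - q) := by
  refine ⟨fun i hi => ?_, ?_⟩
  · simp [hA.1 i hi, hB.1 i hi]
  · simp [hA.2, hB.2]

theorem mul (hA : HasTop A M p) (hB : HasTop B N q) : HasTop (A * B) (M + N) (p * q) := by
  refine ⟨fun i hi => ?_, ?_⟩
  · rw [AddMonoidAlgebra.coeff_mul, Finsupp.sum]
    refine Finset.sum_eq_zero fun j hj => ?_
    rw [Finsupp.sum]
    refine Finset.sum_eq_zero fun k hk => ?_
    rw [if_neg]
    rintro rfl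
    rcases lt_or_ge M j with h | h
    · exact (Finsupp.mem_support_iff.1 hj) (hA.1 j h)
    · exact (Finsupp.mem_support_iff.1 hk) (hB.1 k (by omega))
  · rw [AddMonoidAlgebra.coeff_mul, Finsupp.sum]
    rw [Finset.sum_eq_single M]
    · rw [Finsupp.sum, Finset.sum_eq_single N]
      · rw [if_pos rfl, hA.2, hB.2]
      · intro k _ hk
        rw [if_neg (by omega)]
      · intro h
        rw [Finsupp.notMem_support_iff.1 h]; simp
    · intro j hj hjM
      rw [Finsupp.sum]
      refine Finset.sum_eq_zero fun k hk => ?_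
      rw [if_neg]
      intro h
      rcases lt_or_ge M j with h' | h'
      · exact (Finsupp.mem_support_iff.1 hj) (hA.1 j h')
      · exact (Finsupp.mem_support_iff.1 hk) (hB.1 k (by omega))
    · intro h
      rw [Finsupp.notMem_support_iff.1 h]; simp

theorem C_top (p : ℂ[X]) : HasTop (LaurentPolynomial.C p) 0 p := by
  refine ⟨fun i hi => ?_, by simp⟩
  rw [LaurentPolynomial.C_apply, if_neg hi.ne']

theorem pow (hA : HasTop A M p) (k : ℕ) : HasTop (A ^ k) (k * M) (p ^ k) := by
  induction k with
  | zero =>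
    simp only [pow_zero, Nat.cast_zero, zero_mul]
    exact map_one (LaurentPolynomial.C (R := ℂ[X])) ▸ C_top 1
  | succ k ih =>
    rw [pow_succ, pow_succ]
    convert ih.mul hA using 1
    push_cast; ring

theorem sum {ι : Type*} (s : Finset ι) {A : ι → LPoly} {p : ι → ℂ[X]}
    (h : ∀ i ∈ s, HasTop (A i) M (p i)) : HasTop (∑ i ∈ s, A i) M (∑ i ∈ s, p i) := by
  classical
  induction s using Finset.induction_on with
  | empty => simp [HasTop]
  | insert i s hi ih =>
    rw [Finset.sum_insert hi, Finset.sum_insert hi]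
    exact (h i (Finset.mem_insert_self _ _)).add
      (ih fun j hj => h j (Finset.mem_insert_of_mem hj))

/-- The top coefficient of a monic polynomial expression in `A`. -/
theorem aeval_monic (hA : HasTop A M p) (hM : 0 < M) {α : ℂ[X]} (hα : α.Monic) :
    HasTop (Polynomial.aeval A α) (α.natDegree * M) (p ^ α.natDegree) := by
  rw [Polynomial.aeval_eq_sum_range, Finset.sum_range_succ, hα.coeff_natDegree, one_smul]
  have h0 : HasTop (∑ i ∈ Finset.range α.natDegree, α.coeff i • A ^ i) (α.natDegree * M)
      (∑ i ∈ Finset.range α.natDegree, 0) := by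
    refine HasTop.sum _ fun i hi => ?_
    have hlt : (i : ℤ) * M < α.natDegree * M :=
      mul_lt_mul_of_pos_right (by exact_mod_cast Finset.mem_range.1 hi) hM
    have := (hA.pow i).of_lt hlt
    exact ⟨fun j hj => by simp [this.1 j hj], by simp [this.2]⟩
  simpa using h0.add (hA.pow α.natDegree)

end HasTop

theorem exists_hasTop {A : LPoly} (hA : A ≠ 0) : ∃ M p, p ≠ 0 ∧ HasTop A M p := by
  have hs : A.coeff.support.Nonempty := by
    rw [Finsupp.support_nonempty_iff]
    exact fun h => hA (AddMonoidAlgebra.coeff_eq_zero.1 h)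
  refine ⟨A.coeff.support.max' hs, _, Finsupp.mem_support_iff.1 (Finset.max'_mem _ hs),
    fun i hi => ?_, rfl⟩
  by_contra h
  exact absurd (Finset.le_max' _ i (Finsupp.mem_support_iff.2 h)) (not_le.2 hi)

theorem HasTop.eq_of_ne_zero {A : LPoly} {M N : ℤ} {p q : ℂ[X]} (hA : HasTop A M p)
    (hA' : HasTop A N q) (hp : p ≠ 0) (hq : q ≠ 0) : M = N ∧ p = q := by
  have h : M = N := by
    rcases lt_trichotomy M N with h | h | h
    · exact absurd (hA'.2.symm.trans (hA.1 N h)) hq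
    · exact h
    · exact absurd (hA.2.symm.trans (hA'.1 M h)) hp
  subst h
  exact ⟨rfl, hA.2.symm.trans hA'.2⟩

/-- An additive statement about `ℂ[u][x, x⁻¹]` may be checked on monomials. -/
theorem LPoly.induction_monomial {P : LPoly → Prop} (A : LPoly)
    (hadd : ∀ A B, P A → P B → P (A + B))
    (hmon : ∀ (i : ℤ) (j : ℕ) (c : ℂ),
      P (LaurentPolynomial.C (Polynomial.monomial j c) * LaurentPolynomial.T i)) : P A := by
  induction A using LaurentPolynomial.induction_on' with
  | add A B hA hB => exact hadd A B hA hB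
  | C_mul_T i f =>
    induction f using Polynomial.induction_on' with
    | add f g hf hg =>
      rw [map_add, add_mul]
      exact hadd _ _ hf hg
    | monomial j c => exact hmon i j c

theorem coeff_monomial_mul_T (i k : ℤ) (p : ℂ[X]) :
    (LaurentPolynomial.C p * LaurentPolynomial.T i : LPoly).coeff k = if i = k then p else 0 := by
  rw [← LaurentPolynomial.single_eq_C_mul_T, AddMonoidAlgebra.coeff_single, Finsupp.single_apply]

/-- The derivation `x ∂/∂x`. -/
noncomputable def xDeriv : LPoly →+ LPoly where
  toFun A := .ofCoeff (Finsupp.onFinset A.coeff.support (fun i => (i : ℂ[X]) * A.coeff i)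
    (fun i hi => Finsupp.mem_support_iff.2 (right_ne_zero_of_mul hi)))
  map_zero' := by ext; simp
  map_add' A B := by ext; simp [mul_add]

/-- The derivation `∂/∂u`. -/
noncomputable def uDeriv : LPoly →+ LPoly where
  toFun A := .ofCoeff (A.coeff.mapRange Polynomial.derivative (by simp))
  map_zero' := by ext; simp
  map_add' A B := by ext; simp

theorem coeff_xDeriv (A : LPoly) (i : ℤ) : (xDeriv A).coeff i = (i : ℂ[X]) * A.coeff i := rfl

theorem coeff_uDeriv (A : LPoly) (i : ℤ) :
    (uDeriv A).coeff i = Polynomial.derivative (A.coeff i) := rfl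

/-- The bracket `x (A_x B_u - A_u B_x)`, the Jacobian determinant in the coordinates
`(log x, u)`. -/
noncomputable def bracket (A B : LPoly) : LPoly := xDeriv A * uDeriv B - uDeriv A * xDeriv B

theorem HasTop.bracket {A B : LPoly} {M N : ℤ} {p q : ℂ[X]} (hA : HasTop A M p)
    (hB : HasTop B N q) : HasTop (bracket A B) (M + N)
      ((M : ℂ[X]) * (p * Polynomial.derivative q) - N * (Polynomial.derivative p * q)) := by
  have hx : ∀ {A : LPoly} {M : ℤ} {p : ℂ[X]}, HasTop A M p → HasTop (xDeriv A) M (M * p) :=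
    fun h => ⟨fun i hi => by rw [coeff_xDeriv, h.1 i hi, mul_zero], by rw [coeff_xDeriv, h.2]⟩
  have hu : ∀ {A : LPoly} {M : ℤ} {p : ℂ[X]}, HasTop A M p → HasTop (uDeriv A) M p.derivative :=
    fun h => ⟨fun i hi => by rw [coeff_uDeriv, h.1 i hi, Polynomial.derivative_zero],
      by rw [coeff_uDeriv, h.2]⟩
  have := ((hx hA).mul (hu hB)).sub ((hu hA).mul (hx hB))
  rw [mul_assoc, mul_left_comm _ (N : ℂ[X])] at this
  exact this

theorem xDeriv_monomial (i : ℤ) (p : ℂ[X]) :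
    xDeriv (LaurentPolynomial.C p * LaurentPolynomial.T i) =
      LaurentPolynomial.C ((i : ℂ[X]) * p) * LaurentPolynomial.T i := by
  ext1 k
  rw [coeff_xDeriv, coeff_monomial_mul_T, coeff_monomial_mul_T]
  split_ifs with h
  · rw [h]
  · simp

theorem uDeriv_monomial (i : ℤ) (p : ℂ[X]) :
    uDeriv (LaurentPolynomial.C p * LaurentPolynomial.T i) =
      LaurentPolynomial.C (Polynomial.derivative p) * LaurentPolynomial.T i := by
  ext1 k
  rw [coeff_uDeriv, coeff_monomial_mul_T, coeff_monomial_mul_T]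
  split_ifs <;> simp

/-! ### Changes of the local coordinate -/

/-- The substitution `u ↦ u + c`. -/
noncomputable def translate (c : ℂ) : LPoly →+* LPoly :=
  AddMonoidAlgebra.mapRingHom ℤ (Polynomial.compRingHom (Polynomial.X + Polynomial.C c))

theorem coeff_translate (c : ℂ) (A : LPoly) (i : ℤ) :
    (translate c A).coeff i = (A.coeff i).comp (Polynomial.X + Polynomial.C c) := rfl

theorem bracket_translate (c : ℂ) (A B : LPoly) :
    bracket (translate c A) (translate c B) = translate c (bracket A B) := by
  have hx : ∀ A, xDeriv (translate c A) = translate c (xDeriv A) := by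
    intro A
    ext1 k
    rw [coeff_xDeriv, coeff_translate, coeff_translate, coeff_xDeriv, Polynomial.mul_comp,
      Polynomial.intCast_comp]
  have hu : ∀ A, uDeriv (translate c A) = translate c (uDeriv A) := by
    intro A
    ext1 k
    rw [coeff_uDeriv, coeff_translate, coeff_translate, coeff_uDeriv, Polynomial.derivative_comp]
    simp
  simp only [bracket, hx, hu, map_sub, map_mul]

theorem translate_C_C (c z : ℂ) : translate c (LaurentPolynomial.C (Polynomial.C z)) =
    LaurentPolynomial.C (Polynomial.C z) := by
  ext1 k
  rw [coeff_translate, LaurentPolynomial.C_apply]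
  split_ifs <;> simp

theorem translate_T (c : ℂ) (i : ℤ) : translate c (LaurentPolynomial.T i) =
    LaurentPolynomial.T i := by
  ext1 k
  rw [coeff_translate, LaurentPolynomial.T_apply]
  split_ifs <;> simp

/-- The substitution `x ↦ x ^ q` on powers of `x`. -/
noncomputable def powT (q : ℤ) : Multiplicative ℤ →* LPoly where
  toFun n := LaurentPolynomial.T (q * n.toAdd)
  map_one' := by simp
  map_mul' m n := by rw [toAdd_mul, mul_add, LaurentPolynomial.T_add]

/-- The substitution `u ↦ x ^ (-p) u` on polynomials in `u`. -/
noncomputable def scaleCoeff (p : ℤ) : ℂ[X] →+* LPoly :=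
  Polynomial.eval₂RingHom (LaurentPolynomial.C.comp Polynomial.C)
    (LaurentPolynomial.C Polynomial.X * LaurentPolynomial.T (-p))

/-- The substitution `x ↦ x ^ q`, `u ↦ x ^ (-p) u`. -/
noncomputable def scale (q p : ℤ) : LPoly →+* LPoly :=
  AddMonoidAlgebra.liftNCRingHom (scaleCoeff p) (powT q) (fun _ _ => Commute.all _ _)

theorem scale_single (q p i : ℤ) (f : ℂ[X]) : scale q p (AddMonoidAlgebra.single i f) =
    scaleCoeff p f * LaurentPolynomial.T (q * i) :=
  AddMonoidAlgebra.liftNCRingHom_single _ _ _ _ _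

theorem scale_T (q p i : ℤ) : scale q p (LaurentPolynomial.T i) = LaurentPolynomial.T (q * i) := by
  refine (scale_single q p i 1).trans ?_
  rw [map_one, one_mul]

theorem scale_C (q p : ℤ) (f : ℂ[X]) : scale q p (LaurentPolynomial.C f) = scaleCoeff p f := by
  refine (scale_single q p 0 f).trans ?_
  rw [mul_zero, LaurentPolynomial.T_zero, mul_one]

theorem scaleCoeff_monomial (p : ℤ) (j : ℕ) (c : ℂ) :
    scaleCoeff p (Polynomial.monomial j c) =
      LaurentPolynomial.C (Polynomial.monomial j c) * LaurentPolynomial.T (-p * j) := by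
  rw [scaleCoeff, Polynomial.coe_eval₂RingHom, Polynomial.eval₂_monomial, mul_pow,
    LaurentPolynomial.T_pow, ← Polynomial.C_mul_X_pow_eq_monomial, map_mul, map_pow,
    RingHom.comp_apply, mul_assoc, mul_comm (-p)]

theorem scale_monomial (q p i : ℤ) (j : ℕ) (c : ℂ) :
    scale q p (LaurentPolynomial.C (Polynomial.monomial j c) * LaurentPolynomial.T i) =
      LaurentPolynomial.C (Polynomial.monomial j c) * LaurentPolynomial.T (q * i - p * j) := by
  rw [map_mul, scale_T, scale_C, scaleCoeff_monomial, mul_assoc, ← LaurentPolynomial.T_add]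
  congr 2
  ring

theorem coeff_scale {q p : ℤ} (hq : q ≠ 0) (A : LPoly) (i : ℤ) (j : ℕ) :
    ((scale q p A).coeff (q * i - p * j)).coeff j = (A.coeff i).coeff j := by
  induction A using LPoly.induction_monomial with
  | hadd A B hA hB => simp [hA, hB]
  | hmon i' j' c =>
    rw [scale_monomial, coeff_monomial_mul_T, coeff_monomial_mul_T]
    by_cases hj : j' = j
    · subst hj
      by_cases hi : i' = i
      · simp [hi]
      · rw [if_neg, if_neg hi]
        intro h
        exact hi (mul_left_cancel₀ hq (by linarith))
    · split_ifs <;> simp [Polynomial.coeff_monomial, hj]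

theorem exists_of_coeff_scale_ne_zero {q p : ℤ} {A : LPoly} {k : ℤ} {j : ℕ}
    (h : ((scale q p A).coeff k).coeff j ≠ 0) : ∃ i, k = q * i - p * j := by
  by_contra hk
  apply h
  push Not at hk
  induction A using LPoly.induction_monomial with
  | hadd A B hA hB =>
    rw [map_add, AddMonoidAlgebra.coeff_add, Finsupp.add_apply, Polynomial.coeff_add]
    by_contra hne
    by_cases hA0 : ((scale q p A).coeff k).coeff j = 0
    · by_cases hB0 : ((scale q p B).coeff k).coeff j = 0
      · rw [hA0, hB0, add_zero] at hne; exact hne rfl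
      · exact hB0 (hB hB0)
    · exact hA0 (hA hA0)
  | hmon i' j' c =>
    rw [scale_monomial, coeff_monomial_mul_T]
    split_ifs with h'
    · rw [Polynomial.coeff_monomial, if_neg]
      rintro rfl
      exact hk i' h'.symm
    · simp

theorem bracket_scale (q p : ℤ) (A B : LPoly) :
    bracket (scale q p A) (scale q p B) =
      (q : LPoly) * LaurentPolynomial.T (-p) * scale q p (bracket A B) := by
  have hu : ∀ A, uDeriv (scale q p A) = LaurentPolynomial.T (-p) * scale q p (uDeriv A) := by
    intro A
    induction A using LPoly.induction_monomial with
    | hadd A B hA hB => simp only [map_add, hA, hB, mul_add]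
    | hmon i j c =>
      rw [scale_monomial, uDeriv_monomial, uDeriv_monomial, Polynomial.derivative_monomial,
        scale_monomial]
      rcases j with _ | j
      · simp
      · rw [mul_left_comm, ← LaurentPolynomial.T_add]
        congr 2
        push_cast
        ring
  have hx : ∀ A, xDeriv (scale q p A) = (q : LPoly) * scale q p (xDeriv A) -
      (p : LPoly) * scale q p (LaurentPolynomial.C Polynomial.X * uDeriv A) := by
    intro A
    induction A using LPoly.induction_monomial with
    | hadd A B hA hB => rw [map_add, map_add, hA, hB]; simp only [map_add, mul_add]; ring
    | hmon i j c =>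
      have e1 : ∀ k : ℤ, ((k : ℂ[X]) * Polynomial.monomial j c) = Polynomial.monomial j (k * c) := by
        intro k
        rw [← Polynomial.C_mul_monomial, map_intCast]
      have e2 : Polynomial.X * Polynomial.derivative (Polynomial.monomial j c) =
          Polynomial.monomial j (((j : ℤ) : ℂ) * c) := by
        rw [Polynomial.derivative_monomial, Polynomial.X_mul_monomial]
        rcases j with _ | j
        · simp
        · simp [mul_comm]
      rw [scale_monomial, xDeriv_monomial, xDeriv_monomial, uDeriv_monomial, ← mul_assoc,
        ← map_mul, e2, e1, e1, scale_monomial, scale_monomial, ← mul_assoc, ← mul_assoc,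
        ← sub_mul]
      congr 1
      have e3 : ∀ k : ℤ, (k : LPoly) = LaurentPolynomial.C (k : ℂ[X]) := fun k => by simp
      rw [e3, e3, ← map_mul, ← map_mul, ← map_sub]
      congr 1
      rw [← e1, ← e1, ← e1]
      push_cast
      ring
  simp only [bracket, hx, hu, map_sub, map_mul]
  ring

/-! ### The excess of a vertex over the diagonal -/

/-- The numerical condition that is propagated along a branch at infinity. Here `(w, K)` is a vertex
of the Newton polygon of `W`, `(V, ν)` is a vertex of that of `Z`, and `x ^ ε` is the value of the
bracket of the pair. The middle inequality says that `(V, ν)` lies strictly below the ray through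
`(w, K)`, and the last one bounds its distance to that ray from below. -/
def Unbalanced (a b δ : ℕ) (w V ε : ℤ) (K ν : ℕ) : Prop :=
  (ν : ℤ) < ((a : ℤ) - 1) * δ * K ∧ 0 < V * K - w * ν ∧
    ((a : ℤ) * (K * ε - w) < ((a : ℤ) + b - 1) * (V * K - w * ν) ∨
      (a : ℤ) * (K * ε - w) = ((a : ℤ) + b - 1) * (V * K - w * ν) ∧ 2 ≤ δ * K)

theorem Unbalanced.mono {a b δ : ℕ} {w V V' ε : ℤ} {K ν K' ν' : ℕ} (ha : 0 < a)
    (h : Unbalanced a b δ w V ε K ν) (hK : K' = K)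
    (hν : (ν' : ℤ) < ((a : ℤ) - 1) * δ * K)
    (hX : V * K - w * ν ≤ V' * K - w * ν') : Unbalanced a b δ w V' ε K' ν' := by
  subst hK
  obtain ⟨-, h2, h3⟩ := h
  refine ⟨hν, h2.trans_le hX, ?_⟩
  have hs : 0 ≤ (a : ℤ) + b - 1 := by omega
  have hle := mul_le_mul_of_nonneg_left hX hs
  rcases h3 with h3 | ⟨h3, h4⟩
  · exact Or.inl (h3.trans_le hle)
  · rcases hle.eq_or_lt with h | h
    · exact Or.inr ⟨h3.trans h, h4⟩
    · exact Or.inl (h3.trans_lt h)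

/-- The condition `Unbalanced` is inherited by one of the summands when the two multiplicities are
distributed over finitely many points. -/
theorem Unbalanced.exists_of_sum {ι : Type*} {a b δ : ℕ} {w V ε : ℤ} (ha : 0 < a) (hb : 0 < b)
    (hw : 0 < w) (S : Finset ι) (k n : ι → ℕ)
    (h : Unbalanced a b δ w V ε (∑ i ∈ S, k i) (∑ i ∈ S, n i)) :
    ∃ i ∈ S, Unbalanced a b δ w V ε (k i) (n i) := by
  classical
  by_contra hno
  push Not at hno
  have hh := h
  obtain ⟨h1, h2, h3⟩ := h
  set K := ∑ i ∈ S, k i with hK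
  set N := ∑ i ∈ S, n i with hN
  set s : ℤ := (a : ℤ) + b - 1 with hs
  have hs0 : 0 < s := by omega
  set D : ℤ := ((a : ℤ) - 1) * δ with hD
  have ha' : (0 : ℤ) < a := by exact_mod_cast ha
  have hE0 : (a : ℤ) * (K * ε - w) ≤ s * (V * K - w * N) := by
    rcases h3 with h3 | h3
    · exact h3.le
    · exact h3.1.le
  have hKpos : (0 : ℤ) < K := by
    have : (0 : ℤ) < D * K := lt_of_le_of_lt (by positivity) h1
    rcases Nat.eq_zero_or_pos K with h0 | h0
    · rw [h0] at this; simp at this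
    · exact_mod_cast h0
  -- a member of the family that carries all of `K` inherits the condition directly
  have hsingle : ∀ i ∈ S, k i = K → ¬ (V * K - w * N ≤ V * K - w * n i ∧ (n i : ℤ) < D * K) :=
    fun i hi hki hX => hno i hi (hh.mono ha hki hX.2 hX.1)
  -- on the members satisfying the first two conditions, the third fails
  have hfail : ∀ i ∈ S, (n i : ℤ) < D * k i → 0 < V * k i - w * n i →
      s * (V * k i - w * n i) ≤ a * (k i * ε - w) := by
    intro i hi h1' h2'
    by_contra hlt
    exact hno i hi ⟨h1', h2', Or.inl (not_le.1 hlt)⟩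
  have hε : ∀ i ∈ S, (n i : ℤ) < D * k i → 0 < V * k i - w * n i → 0 < ε := by
    intro i hi h1' h2'
    have h3' := hfail i hi h1' h2'
    by_contra hneg
    have h4 : (a : ℤ) * (k i * ε - w) < 0 := by
      apply mul_neg_of_pos_of_neg ha'
      have : (k i : ℤ) * ε ≤ 0 := mul_nonpos_of_nonneg_of_nonpos (by positivity) (not_lt.1 hneg)
      linarith
    have := mul_pos hs0 h2'
    linarith
  have hsumX : ∑ i ∈ S, (V * k i - w * n i) = V * K - w * N := by
    rw [Finset.sum_sub_distrib, ← Finset.mul_sum, ← Finset.mul_sum, hK, hN]; push_cast; ring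
  have hsumr : ∑ i ∈ S, (D * k i - n i) = D * K - N := by
    rw [Finset.sum_sub_distrib, ← Finset.mul_sum, hK, hN]; push_cast; ring
  have hX : ∀ i, V * k i - w * n i = (V - w * D) * k i + w * (D * k i - n i) := fun i => by ring
  have hsub : ∀ S' ⊆ S, ((∑ i ∈ S', k i : ℕ) : ℤ) ≤ K := by
    intro S' hS'
    exact_mod_cast Finset.sum_le_sum_of_subset hS'
  have hsumY : ∀ S' : Finset ι, ∑ i ∈ S', (a : ℤ) * (k i * ε - w) =
      a * (((∑ i ∈ S', k i : ℕ) : ℤ) * ε - S'.card * w) := by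
    intro S'
    rw [← Finset.mul_sum, Finset.sum_sub_distrib, ← Finset.sum_mul]
    simp
  -- a one-element subfamily carrying all of `K`
  have hfinal : ∀ S' ⊆ S, S'.card = 1 → ((∑ i ∈ S', k i : ℕ) : ℤ) = K →
      (∀ i ∈ S', V * K - w * N ≤ V * k i - w * n i ∧ (n i : ℤ) < D * k i) → False := by
    intro S' hS' hc hkk hall
    obtain ⟨i, rfl⟩ := Finset.card_eq_one.1 hc
    rw [Finset.sum_singleton] at hkk
    have hki : k i = K := by exact_mod_cast hkk
    have := hall i (Finset.mem_singleton_self i)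
    rw [hki] at this
    exact hsingle i (hS' (Finset.mem_singleton_self i)) hki this
  rcases le_or_gt (V - w * D) 0 with hρ | hρ
  · -- here the second condition implies the first
    set S' := S.filter (fun i => 0 < V * k i - w * (n i : ℤ)) with hS'
    have hS'S : S' ⊆ S := Finset.filter_subset _ _
    have hmem : ∀ i ∈ S', 0 < V * k i - w * (n i : ℤ) := fun i hi => (Finset.mem_filter.1 hi).2
    have hr : ∀ i ∈ S', (n i : ℤ) < D * k i := by
      intro i hi
      have h4 := hmem i hi
      rw [hX] at h4
      have h5 : (V - w * D) * (k i : ℤ) ≤ 0 := mul_nonpos_of_nonpos_of_nonneg hρ (by positivity)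
      have h6 : 0 < w * (D * k i - n i) := by linarith
      have := pos_of_mul_pos_right h6 hw.le
      linarith
    have hsum : V * K - w * N ≤ ∑ i ∈ S', (V * k i - w * (n i : ℤ)) := by
      rw [← hsumX, ← Finset.sum_filter_add_sum_filter_not S (fun i => 0 < V * k i - w * (n i : ℤ))]
      have : ∑ i ∈ S.filter (fun i => ¬ 0 < V * k i - w * (n i : ℤ)),
          (V * k i - w * (n i : ℤ)) ≤ 0 :=
        Finset.sum_nonpos fun i hi => not_lt.1 (Finset.mem_filter.1 hi).2
      linarith
    have hne : S'.Nonempty := by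
      rw [Finset.nonempty_iff_ne_empty]
      intro h0
      rw [h0, Finset.sum_empty] at hsum
      linarith
    obtain ⟨i0, hi0⟩ := hne
    have hε0 := hε i0 (hS'S hi0) (hr i0 hi0) (hmem i0 hi0)
    have hcard : (1 : ℤ) ≤ S'.card := by exact_mod_cast Finset.card_pos.2 ⟨i0, hi0⟩
    have hE : s * ∑ i ∈ S', (V * k i - w * (n i : ℤ)) ≤
        a * (((∑ i ∈ S', k i : ℕ) : ℤ) * ε - S'.card * w) := by
      rw [← hsumY, Finset.mul_sum]
      exact Finset.sum_le_sum fun i hi => hfail i (hS'S hi) (hr i hi) (hmem i hi)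
    have hk' := hsub S' hS'S
    have hle := mul_le_mul_of_nonneg_left hsum hs0.le
    have hcomb : (K : ℤ) * ε - w ≤ ((∑ i ∈ S', k i : ℕ) : ℤ) * ε - S'.card * w :=
      le_of_mul_le_mul_left (hE0.trans (hle.trans hE)) ha'
    have h7 : 0 ≤ ((K : ℤ) - ((∑ i ∈ S', k i : ℕ) : ℤ)) * ε :=
      mul_nonneg (by linarith) hε0.le
    have h8 : 0 ≤ ((S'.card : ℤ) - 1) * w := mul_nonneg (by linarith) hw.le
    have h9 : ((K : ℤ) - ((∑ i ∈ S', k i : ℕ) : ℤ)) * ε = 0 := by linarith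
    have h10 : ((S'.card : ℤ) - 1) * w = 0 := by linarith
    have h11 : S'.card = 1 := by
      rcases mul_eq_zero.1 h10 with h | h
      · have : (S'.card : ℤ) = 1 := by linarith
        exact_mod_cast this
      · exact absurd h hw.ne'
    have h12 : ((∑ i ∈ S', k i : ℕ) : ℤ) = K := by
      rcases mul_eq_zero.1 h9 with h | h
      · linarith
      · exact absurd h hε0.ne'
    refine hfinal S' hS'S h11 h12 fun i hi => ⟨?_, hr i hi⟩
    obtain ⟨j, hj⟩ := Finset.card_eq_one.1 h11
    rw [hj] at hi hsum
    rw [Finset.mem_singleton.1 hi]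
    simpa using hsum
  · -- here the first condition implies the second
    set S' := S.filter (fun i => 0 < D * k i - (n i : ℤ)) with hS'
    have hS'S : S' ⊆ S := Finset.filter_subset _ _
    have hmem : ∀ i ∈ S', 0 < D * k i - (n i : ℤ) := fun i hi => (Finset.mem_filter.1 hi).2
    have hr : ∀ i ∈ S', (n i : ℤ) < D * k i := fun i hi => by linarith [hmem i hi]
    have hXpos : ∀ i ∈ S', 0 < V * k i - w * (n i : ℤ) := by
      intro i hi
      rw [hX]
      have h5 : 0 ≤ (V - w * D) * (k i : ℤ) := mul_nonneg hρ.le (by positivity)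
      have h6 : 0 < w * (D * k i - n i) := mul_pos hw (hmem i hi)
      linarith
    have hsum : D * K - N ≤ ∑ i ∈ S', (D * k i - (n i : ℤ)) := by
      rw [← hsumr, ← Finset.sum_filter_add_sum_filter_not S (fun i => 0 < D * k i - (n i : ℤ))]
      have : ∑ i ∈ S.filter (fun i => ¬ 0 < D * k i - (n i : ℤ)),
          (D * k i - (n i : ℤ)) ≤ 0 :=
        Finset.sum_nonpos fun i hi => not_lt.1 (Finset.mem_filter.1 hi).2
      linarith
    have hr0 : 0 < D * K - N := by linarith
    have hne : S'.Nonempty := by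
      rw [Finset.nonempty_iff_ne_empty]
      intro h0
      rw [h0, Finset.sum_empty] at hsum
      linarith
    obtain ⟨i0, hi0⟩ := hne
    have hcard : (1 : ℤ) ≤ S'.card := by exact_mod_cast Finset.card_pos.2 ⟨i0, hi0⟩
    set k' : ℤ := ((∑ i ∈ S', k i : ℕ) : ℤ) with hk'def
    have hsumX' : ∑ i ∈ S', (V * k i - w * (n i : ℤ)) =
        (V - w * D) * k' + w * ∑ i ∈ S', (D * k i - (n i : ℤ)) := by
      rw [Finset.sum_congr rfl fun i _ => hX i, Finset.sum_add_distrib, ← Finset.mul_sum,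
        ← Finset.mul_sum, hk'def]
      push_cast; rfl
    have hE : s * ∑ i ∈ S', (V * k i - w * (n i : ℤ)) ≤ a * (k' * ε - S'.card * w) := by
      rw [hk'def, ← hsumY, Finset.mul_sum]
      exact Finset.sum_le_sum fun i hi => hfail i (hS'S hi) (hr i hi) (hXpos i hi)
    have hk' : k' ≤ K := hsub S' hS'S
    have hk'0 : 0 ≤ k' := by positivity
    have hE1 : s * ((V - w * D) * k' + w * (D * K - N)) ≤ a * (k' * ε - S'.card * w) := by
      refine le_trans (mul_le_mul_of_nonneg_left ?_ hs0.le) hE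
      rw [hsumX']
      linarith [mul_le_mul_of_nonneg_left hsum hw.le]
    have hE2 : (a : ℤ) * (K * ε - w) ≤ s * ((V - w * D) * K + w * (D * K - N)) := by
      refine hE0.trans_eq ?_
      ring
    -- eliminate the slope by interpolating between `0` and `K`
    have h5 := mul_le_mul_of_nonneg_left hE1 hKpos.le
    have h6 := mul_le_mul_of_nonneg_left hE2 hk'0
    have h7 : s * w * (D * K - N) * (K - k') + a * w * (K * S'.card - k') ≤ 0 := by
      linarith [h5, h6]
    have h8 : 0 ≤ s * w * (D * K - N) * (K - k') :=
      mul_nonneg (mul_nonneg (mul_nonneg hs0.le hw.le) hr0.le) (by linarith)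
    have h9 : (K : ℤ) ≤ K * S'.card := le_mul_of_one_le_right hKpos.le hcard
    have h10 : 0 ≤ a * w * (K * S'.card - k') :=
      mul_nonneg (mul_nonneg ha'.le hw.le) (by linarith)
    have h11 : s * w * (D * K - N) * (K - k') = 0 := by linarith
    have h12 : (a : ℤ) * w * (K * S'.card - k') = 0 := by linarith
    have h13 : k' = K := by
      rcases mul_eq_zero.1 h11 with h | h
      · exact absurd h (mul_pos (mul_pos hs0 hw) hr0).ne'
      · linarith
    have h14 : S'.card = 1 := by
      rcases mul_eq_zero.1 h12 with h | h
      · exact absurd h (mul_pos ha' hw).ne'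
      · rw [h13] at h
        have : (K : ℤ) * ((S'.card : ℤ) - 1) = 0 := by linarith
        rcases mul_eq_zero.1 this with h | h
        · exact absurd h hKpos.ne'
        · have : (S'.card : ℤ) = 1 := by linarith
          exact_mod_cast this
    refine hfinal S' hS'S h14 h13 fun i hi => ⟨?_, hr i hi⟩
    obtain ⟨j, hj⟩ := Finset.card_eq_one.1 h14
    have hij : i = j := by rw [hj] at hi; exact Finset.mem_singleton.1 hi
    have hki : (k i : ℤ) = K := by
      rw [← h13, hk'def, hj, Finset.sum_singleton, hij]
    have hri : D * K - N ≤ D * k i - (n i : ℤ) := by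
      rw [hj, Finset.sum_singleton, ← hij] at hsum
      exact hsum
    have := mul_le_mul_of_nonneg_left hri hw.le
    rw [hki] at this ⊢
    linarith

theorem sum_rootMultiplicity {p : ℂ[X]} {S : Finset ℂ} (hS : p.roots.toFinset ⊆ S) :
    ∑ x ∈ S, p.rootMultiplicity x = p.natDegree := by
  rw [(IsAlgClosed.splits p).natDegree_eq_card_roots, ← Multiset.toFinset_sum_count_eq,
    ← Finset.sum_subset hS]
  · exact Finset.sum_congr rfl fun x _ => (Polynomial.count_roots p).symm
  · intro x _ hx
    rw [← Polynomial.count_roots, Multiset.count_eq_zero]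
    exact fun h => hx (Multiset.mem_toFinset.2 h)

/-- One of the roots of the leading coefficients inherits the condition `Unbalanced`. -/
theorem Unbalanced.exists_root {a b δ : ℕ} {w V ε : ℤ} (ha : 0 < a) (hb : 0 < b) (hw : 0 < w)
    {ω ζ : ℂ[X]} (h : Unbalanced a b δ w V ε ω.natDegree ζ.natDegree) :
    ∃ x, Unbalanced a b δ w V ε (ω.rootMultiplicity x) (ζ.rootMultiplicity x) := by
  rw [← sum_rootMultiplicity (Finset.subset_union_left (s₂ := ζ.roots.toFinset)),
    ← sum_rootMultiplicity (p := ζ) (Finset.subset_union_right (s₁ := ω.roots.toFinset))] at h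
  obtain ⟨x, -, hx⟩ := h.exists_of_sum ha hb hw
  exact ⟨x, hx⟩

/-! ### Branches at infinity -/

/-- A local picture of a Jacobian pair at a branch at infinity. The first member of the pair is
`α(W) + Z`, and the top coefficients `ω`, `ψ`, `ζ` of `W`, `G`, `Z` satisfy the condition
`Unbalanced`. -/
structure BranchState (a b δ : ℕ) (α : ℂ[X]) (W G Z : LPoly) (w V ε : ℤ) (ω ψ ζ : ℂ[X]) (c : ℂ) :
    Prop where
  w_pos : 0 < w
  topW : HasTop W w ω
  topG : HasTop G (b * δ * w) ψ
  topZ : HasTop Z V ζ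
  ψ_ne : ψ ≠ 0
  ζ_ne : ζ ≠ 0
  V_le : V ≤ a * δ * w
  bracket_eq : bracket (Polynomial.aeval W α + Z) G =
    LaurentPolynomial.C (Polynomial.C c) * LaurentPolynomial.T ε
  unbalanced : Unbalanced a b δ w V ε ω.natDegree ζ.natDegree

/-- The degree `ε` of the bracket is less than the sum of the degrees of the pair, so the bracket of
the top terms has to vanish. -/
theorem Unbalanced.lt_degree_sum {a b δ : ℕ} {w V ε : ℤ} {K ν : ℕ} (ha : 0 < a) (hw : 0 < w)
    (hV : V ≤ a * δ * w) (h : Unbalanced a b δ w V ε K ν) : ε < a * δ * w + b * δ * w := by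
  obtain ⟨h1, h2, h3⟩ := h
  have ha' : (0 : ℤ) < a := by exact_mod_cast ha
  have hpos : (0 : ℤ) < ((a : ℤ) - 1) * δ * K := lt_of_le_of_lt (by positivity) h1
  have hδK : (1 : ℤ) ≤ δ * K := by
    have : (δ * K : ℕ) ≠ 0 := by
      intro h0
      have h0' : ((δ * K : ℕ) : ℤ) = 0 := by rw [h0]; rfl
      push_cast at h0'
      rw [mul_assoc, h0', mul_zero] at hpos
      exact lt_irrefl _ hpos
    exact_mod_cast Nat.one_le_iff_ne_zero.2 this
  have hK : (0 : ℤ) < K := by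
    rcases Nat.eq_zero_or_pos K with h0 | h0
    · rw [h0] at hδK; simp at hδK
    · exact_mod_cast h0
  have hs : 0 ≤ (a : ℤ) + b - 1 := by omega
  have hX : V * K - w * ν ≤ a * δ * w * K := by
    have e1 := mul_le_mul_of_nonneg_right hV hK.le
    have e2 : 0 ≤ w * (ν : ℤ) := by positivity
    linarith
  have hXs := mul_le_mul_of_nonneg_left hX hs
  have key : (a : ℤ) * (K * ε) < a * (K * (a * δ * w + b * δ * w)) := by
    have e : (a : ℤ) * (K * (a * δ * w + b * δ * w)) - (((a : ℤ) + b - 1) * (a * δ * w * K) + a * w)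
        = a * w * (δ * K - 1) := by ring
    rcases h3 with h3 | ⟨h3, h4⟩
    · have : 0 ≤ (a : ℤ) * w * (δ * K - 1) := by
        apply mul_nonneg (mul_nonneg ha'.le hw.le); linarith
      linarith
    · have h4' : (2 : ℤ) ≤ δ * K := by exact_mod_cast h4
      have : 0 < (a : ℤ) * w * (δ * K - 1) := by
        apply mul_pos (mul_pos ha' hw); linarith
      linarith
  have := lt_of_mul_lt_mul_left key ha'.le
  exact lt_of_mul_lt_mul_left this hK.le

namespace BranchState

variable {a b δ : ℕ} {α : ℂ[X]} {W G Z : LPoly} {w V ε : ℤ} {ω ψ ζ : ℂ[X]} {c : ℂ}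

theorem natDegree_pos (h : BranchState a b δ α W G Z w V ε ω ψ ζ c) : 0 < δ ∧ 0 < ω.natDegree := by
  have h1 := lt_of_le_of_lt (Int.natCast_nonneg _) h.unbalanced.1
  constructor
  · rcases Nat.eq_zero_or_pos δ with h0 | h0
    · rw [h0] at h1; simp at h1
    · exact h0
  · rcases Nat.eq_zero_or_pos ω.natDegree with h0 | h0
    · rw [h0] at h1; simp at h1
    · exact h0

/-- At a branch state the polynomial `Z` does not contribute to the top term of `α(W) + Z`, and the
top coefficient of `G` is proportional to a power of that of `W`. The reason is that the top
coefficient of `α(W) + Z` is an `a`-th power, as is that of `α(W)`, while the degree of `ζ` is too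
small for a nonzero difference of such powers. -/
theorem rigid (ha : 0 < a) (hab : Nat.Coprime a b) (hα : α.Monic) (hdeg : α.natDegree = a * δ)
    (h : BranchState a b δ α W G Z w V ε ω ψ ζ c) :
    V < a * δ * w ∧ ∃ z : ℂ, ψ = Polynomial.C z * ω ^ (b * δ) := by
  obtain ⟨hδ, hK⟩ := h.natDegree_pos
  have hω : ω ≠ 0 := by rintro rfl; simp at hK
  have hdegZ : ζ.natDegree < (a - 1) * (ω ^ δ).natDegree := by
    have := h.unbalanced.1
    rw [Polynomial.natDegree_pow]
    zify [ha]
    rw [← mul_assoc]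
    exact this
  -- the contribution of `Z` in the degree of `α(W)`
  obtain ⟨η, hη, hηζ⟩ : ∃ η, HasTop Z (a * δ * w) η ∧ (η = 0 ∨ η = ζ) := by
    rcases h.V_le.eq_or_lt with hV | hV
    · exact ⟨ζ, hV ▸ h.topZ, Or.inr rfl⟩
    · exact ⟨0, h.topZ.of_lt hV, Or.inl rfl⟩
  have hηdeg : η.natDegree < (a - 1) * (ω ^ δ).natDegree := by
    rcases hηζ with rfl | rfl
    · rw [Polynomial.natDegree_zero]
      exact (Nat.zero_le _).trans_lt hdegZ
    · exact hdegZ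
  have hF : HasTop (Polynomial.aeval W α + Z) (a * δ * w) ((ω ^ δ) ^ a + η) := by
    have := h.topW.aeval_monic h.w_pos hα
    rw [hdeg, mul_comm a δ, pow_mul] at this
    push_cast at this
    rw [mul_comm (δ : ℤ)] at this
    exact this.add hη
  have hg0 : ω ^ δ ≠ 0 := pow_ne_zero _ hω
  have hφ : (ω ^ δ) ^ a + η ≠ 0 := by
    intro h0
    have h1 : (ω ^ δ) ^ a = -η := eq_neg_of_add_eq_zero_left h0
    have h2 := congrArg Polynomial.natDegree h1
    rw [Polynomial.natDegree_neg, Polynomial.natDegree_pow] at h2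
    have h3 : (a - 1) * (ω ^ δ).natDegree ≤ a * (ω ^ δ).natDegree :=
      Nat.mul_le_mul_right _ (Nat.sub_le _ _)
    omega
  have hbr := (hF.bracket h.topG).2
  have hε := h.unbalanced.lt_degree_sum ha h.w_pos h.V_le
  rw [h.bracket_eq, coeff_monomial_mul_T, if_neg hε.ne] at hbr
  have hode : (a : ℂ[X]) * (((ω ^ δ) ^ a + η) * ψ.derivative) =
      b * (((ω ^ δ) ^ a + η).derivative * ψ) := by
    have hδw : ((δ : ℂ[X]) * (w : ℂ[X])) ≠ 0 := by
      refine mul_ne_zero (by exact_mod_cast hδ.ne') ?_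
      exact_mod_cast h.w_pos.ne'
    apply mul_left_cancel₀ hδw
    push_cast at hbr
    linear_combination -hbr
  obtain ⟨f, z, hz, hf, hψ⟩ := exists_common_root_of_derivative_eq ha hab hφ h.ψ_ne hode
  have hdiff : f ^ a - (ω ^ δ) ^ a = η := by rw [← hf]; ring
  obtain ⟨t, hta, hft⟩ := eq_C_mul_of_natDegree_pow_sub_lt ha (f := f) hg0
    (by rw [hdiff]; exact hηdeg)
  have hη0 : η = 0 := by
    rw [← hdiff, hft, mul_pow, ← Polynomial.C_pow, hta, Polynomial.C_1, one_mul, sub_self]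
  constructor
  · refine lt_of_le_of_ne h.V_le fun hV => ?_
    rw [hη0] at hη
    exact h.ζ_ne (h.topZ.2.symm.trans (hV ▸ hη.2))
  · refine ⟨z * t ^ b, ?_⟩
    rw [hψ, hft, mul_pow, Polynomial.C_mul, Polynomial.C_pow, mul_comm b δ, pow_mul, mul_assoc]

end BranchState

/-! ### Newton polygon edges -/

/-- The lowest monomial of the top coefficient of `A` is `x ^ M u ^ k`. -/
structure HasCorner (A : LPoly) (M : ℤ) (k : ℕ) : Prop where
  eq_zero : ∀ i, M < i → A.coeff i = 0
  coeff_eq_zero : ∀ j < k, (A.coeff M).coeff j = 0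
  coeff_ne_zero : (A.coeff M).coeff k ≠ 0

theorem HasTop.hasCorner_translate {A : LPoly} {M : ℤ} {p : ℂ[X]} (h : HasTop A M p) (hp : p ≠ 0)
    (x : ℂ) : HasCorner (translate x A) M (p.rootMultiplicity x) := by
  have hp' : p.comp (Polynomial.X + Polynomial.C x) ≠ 0 := by
    rwa [Ne, Polynomial.comp_X_add_C_eq_zero_iff]
  rw [Polynomial.rootMultiplicity_eq_natTrailingDegree]
  refine ⟨fun i hi => ?_, fun j hj => ?_, ?_⟩
  · rw [coeff_translate, h.1 i hi, Polynomial.zero_comp]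
  · rw [coeff_translate, h.2]
    exact Polynomial.coeff_eq_zero_of_lt_natTrailingDegree hj
  · rw [coeff_translate, h.2]
    exact Polynomial.trailingCoeff_nonzero_iff_nonzero.2 hp'

/-- The slopes of the segments that join `(M, k)` to the monomials of `A` of lower degree in `u`. -/
noncomputable def slopes (A : LPoly) (M : ℤ) (k : ℕ) : Finset ℚ :=
  ((A.coeff.support ×ˢ Finset.range k).filter fun ij => (A.coeff ij.1).coeff ij.2 ≠ 0).image
    fun ij => ((M - ij.1 : ℤ) : ℚ) / ((k - ij.2 : ℤ) : ℚ)

theorem mem_slopes {A : LPoly} {M : ℤ} {k : ℕ} {s : ℚ} : s ∈ slopes A M k ↔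
    ∃ (i : ℤ) (j : ℕ), j < k ∧ (A.coeff i).coeff j ≠ 0 ∧
      s = ((M - i : ℤ) : ℚ) / ((k - j : ℤ) : ℚ) := by
  simp only [slopes, Finset.mem_image, Finset.mem_filter, Finset.mem_product, Finset.mem_range,
    Finsupp.mem_support_iff, Prod.exists]
  constructor
  · rintro ⟨i, j, ⟨⟨-, hj⟩, hij⟩, rfl⟩
    exact ⟨i, j, hj, hij, rfl⟩
  · rintro ⟨i, j, hj, hij, rfl⟩
    refine ⟨i, j, ⟨⟨fun h0 => ?_, hj⟩, hij⟩, rfl⟩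
    rw [h0] at hij
    simp at hij

section scale

variable {A : LPoly} {M : ℤ} {k : ℕ} {s : ℚ}

/-- If `s = p / q` is at most every slope, then after the rescaling with slope `s` all monomials
have degree at most that of the image of `(M, k)`. -/
theorem scale_le (hA : ∀ i, M < i → A.coeff i = 0) (hs0 : 0 < s) (hs : ∀ t ∈ slopes A M k, s ≤ t)
    {i : ℤ} {j : ℕ} (hij : (A.coeff i).coeff j ≠ 0) :
    s.den * i - s.num * j ≤ s.den * M - s.num * k := by
  have hiM : i ≤ M := by
    by_contra h
    rw [hA i (not_le.1 h)] at hij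
    simp at hij
  have hnum : 0 < s.num := Rat.num_pos.2 hs0
  have hden : (0 : ℤ) < s.den := by exact_mod_cast s.den_pos
  rcases lt_or_ge j k with hj | hj
  · have := hs _ (mem_slopes.2 ⟨i, j, hj, hij, rfl⟩)
    have hkj : (0 : ℤ) < k - j := by omega
    rw [le_div_iff₀ (by exact_mod_cast hkj), ← Rat.num_div_den s, div_mul_eq_mul_div,
      div_le_iff₀ (by exact_mod_cast s.den_pos)] at this
    have h2 : s.num * (k - j) ≤ (M - i) * s.den := by exact_mod_cast this
    linarith
  · have h1 : (s.den : ℤ) * i ≤ s.den * M := mul_le_mul_of_nonneg_left hiM hden.le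
    have h2 : s.num * (k : ℤ) ≤ s.num * j :=
      mul_le_mul_of_nonneg_left (by exact_mod_cast hj) hnum.le
    linarith

theorem hasTop_scale (hA : ∀ i, M < i → A.coeff i = 0) (hs0 : 0 < s)
    (hs : ∀ t ∈ slopes A M k, s ≤ t) :
    HasTop (scale s.den s.num A) (s.den * M - s.num * k)
      ((scale s.den s.num A).coeff (s.den * M - s.num * k)) := by
  have hden : (s.den : ℤ) ≠ 0 := by exact_mod_cast s.den_pos.ne'
  refine ⟨fun i hi => ?_, rfl⟩
  ext j
  rw [Polynomial.coeff_zero]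
  by_contra hne
  obtain ⟨i', rfl⟩ := exists_of_coeff_scale_ne_zero hne
  rw [coeff_scale hden] at hne
  exact absurd (scale_le hA hs0 hs hne) (not_le.2 hi)

theorem natDegree_coeff_scale_le (hA : ∀ i, M < i → A.coeff i = 0) (hs0 : 0 < s) :
    ((scale s.den s.num A).coeff (s.den * M - s.num * k)).natDegree ≤ k := by
  have hden : (s.den : ℤ) ≠ 0 := by exact_mod_cast s.den_pos.ne'
  rw [Polynomial.natDegree_le_iff_coeff_eq_zero]
  intro j hj
  by_contra hne
  obtain ⟨i, hi⟩ := exists_of_coeff_scale_ne_zero hne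
  rw [hi, coeff_scale hden] at hne
  have hnum : 0 < s.num := Rat.num_pos.2 hs0
  have h2 : s.num * (k : ℤ) < s.num * j :=
    mul_lt_mul_of_pos_left (by exact_mod_cast hj) hnum
  have h3 : (s.den : ℤ) * M < s.den * i := by linarith
  have h4 := lt_of_mul_lt_mul_left h3 (by positivity)
  rw [hA i h4] at hne
  simp at hne

theorem natDegree_coeff_scale (hA : HasCorner A M k) (hs0 : 0 < s) :
    ((scale s.den s.num A).coeff (s.den * M - s.num * k)).natDegree = k := by
  have hden : (s.den : ℤ) ≠ 0 := by exact_mod_cast s.den_pos.ne'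
  refine le_antisymm (natDegree_coeff_scale_le hA.eq_zero hs0) ?_
  apply Polynomial.le_natDegree_of_ne_zero
  rw [coeff_scale hden]
  exact hA.coeff_ne_zero

theorem exists_coeff_scale_of_mem (hs : s ∈ slopes A M k) :
    ∃ j < k, ((scale s.den s.num A).coeff (s.den * M - s.num * k)).coeff j ≠ 0 := by
  have hden : (s.den : ℤ) ≠ 0 := by exact_mod_cast s.den_pos.ne'
  obtain ⟨i, j, hj, hij, h⟩ := mem_slopes.1 hs
  refine ⟨j, hj, ?_⟩
  have hkj : (0 : ℤ) < k - j := by omega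
  have e : (s.den : ℤ) * M - s.num * k = s.den * i - s.num * j := by
    have h' : (s.num : ℚ) / s.den = ((M - i : ℤ) : ℚ) / ((k - j : ℤ) : ℚ) := by
      rw [Rat.num_div_den]; exact h
    rw [div_eq_div_iff (by exact_mod_cast hden) (by exact_mod_cast hkj.ne')] at h'
    have h2 : s.num * (k - j) = (M - i) * s.den := by exact_mod_cast h'
    linarith
  rwa [e, coeff_scale hden]

theorem pos_of_mem_slopes (hA : HasCorner A M k) (hs : s ∈ slopes A M k) : 0 < s := by
  obtain ⟨i, j, hj, hij, rfl⟩ := mem_slopes.1 hs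
  have hkj : (0 : ℤ) < k - j := by omega
  have hiM : i < M := by
    rcases lt_trichotomy i M with h | h | h
    · exact h
    · rw [h] at hij; exact absurd (hA.coeff_eq_zero j hj) hij
    · rw [hA.eq_zero i h] at hij; simp at hij
  have hMi : (0 : ℤ) < M - i := by omega
  exact div_pos (by exact_mod_cast hMi) (by exact_mod_cast hkj)

theorem pos_of_mem_slopes_of_lt {V : ℤ} (hA : ∀ i, V < i → A.coeff i = 0) (hV : V < M)
    (hs : s ∈ slopes A M k) : 0 < s := by
  obtain ⟨i, j, hj, hij, rfl⟩ := mem_slopes.1 hs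
  have hkj : (0 : ℤ) < k - j := by omega
  have hiM : 0 < M - i := by
    by_contra h
    rw [hA i (by omega)] at hij; simp at hij
  exact div_pos (by exact_mod_cast hiM) (by exact_mod_cast hkj)

end scale

/-- Ring endomorphisms fixing the constants commute with polynomial expressions. -/
theorem map_aeval_of_fix (φ : LPoly →+* LPoly)
    (hφ : ∀ z : ℂ, φ (LaurentPolynomial.C (Polynomial.C z)) = LaurentPolynomial.C (Polynomial.C z))
    (A : LPoly) (α : ℂ[X]) : φ (Polynomial.aeval A α) = Polynomial.aeval (φ A) α := by
  rw [Polynomial.aeval_def, Polynomial.aeval_def, Polynomial.hom_eval₂]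
  congr 1
  ext1 z
  exact hφ z

theorem scale_C_C (q p : ℤ) (z : ℂ) : scale q p (LaurentPolynomial.C (Polynomial.C z)) =
    LaurentPolynomial.C (Polynomial.C z) := by
  have := scaleCoeff_monomial p 0 z
  rw [scale_C]
  simpa using this

/-! ### Descent along a branch -/

theorem Unbalanced.rescale {a b δ : ℕ} {w V ε : ℤ} {K ν : ℕ} {q : ℤ} (hq : 0 < q) (p : ℤ)
    (h : Unbalanced a b δ w V ε K ν) :
    Unbalanced a b δ (q * w - p * K) (q * V - p * ν) (q * ε - p) K ν := by
  obtain ⟨h1, h2, h3⟩ := h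
  have e1 : (q * V - p * ν) * K - (q * w - p * K) * ν = q * (V * K - w * ν) := by ring
  have e2 : (a : ℤ) * (K * (q * ε - p) - (q * w - p * K)) = q * (a * (K * ε - w)) := by ring
  have e3 : ((a : ℤ) + b - 1) * (q * (V * K - w * ν)) =
      q * (((a : ℤ) + b - 1) * (V * K - w * ν)) := by ring
  refine ⟨h1, ?_, ?_⟩
  · rw [e1]; exact mul_pos hq h2
  · rw [e1, e2, e3]
    rcases h3 with h3 | ⟨h3, h4⟩
    · exact Or.inl (mul_lt_mul_of_pos_left h3 hq)
    · exact Or.inr ⟨by rw [h3], h4⟩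

/-- A branch state in which a root of the leading coefficients has been moved to `u = 0`, so that
only the corners at this root matter. -/
structure BranchCorner (a b δ : ℕ) (α : ℂ[X]) (W G Z : LPoly) (w V ε : ℤ) (K ν : ℕ) (c : ℂ) :
    Prop where
  w_pos : 0 < w
  cornerW : HasCorner W w K
  cornerG : HasCorner G (b * δ * w) (b * δ * K)
  topZ : ∀ i, V < i → Z.coeff i = 0
  coeffZ : (Z.coeff V).coeff ν ≠ 0
  V_lt : V < a * δ * w
  bracket_eq : bracket (Polynomial.aeval W α + Z) G =
    LaurentPolynomial.C (Polynomial.C c) * LaurentPolynomial.T ε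
  unbalanced : Unbalanced a b δ w V ε K ν

variable {a b δ : ℕ} {α : ℂ[X]} {W G Z : LPoly} {w V ε : ℤ} {c : ℂ}

/-- From a branch state one passes to one of the roots of the top coefficients. -/
theorem BranchState.exists_branchCorner {ω ψ ζ : ℂ[X]} (ha : 0 < a) (hb : 0 < b)
    (hab : Nat.Coprime a b) (hα : α.Monic) (hdeg : α.natDegree = a * δ)
    (h : BranchState a b δ α W G Z w V ε ω ψ ζ c) :
    ∃ x, BranchCorner a b δ α (translate x W) (translate x G) (translate x Z) w V ε
      (ω.rootMultiplicity x) (ζ.rootMultiplicity x) c := by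
  obtain ⟨hV, z, hz⟩ := h.rigid ha hab hα hdeg
  obtain ⟨x, hx⟩ := h.unbalanced.exists_root ha hb h.w_pos
  have hω : ω ≠ 0 := by
    rintro rfl
    exact lt_irrefl _ h.natDegree_pos.2
  have hmult : ψ.rootMultiplicity x = b * δ * ω.rootMultiplicity x := by
    have hz0 : z ≠ 0 := by
      rintro rfl
      exact h.ψ_ne (by rw [hz]; simp)
    rw [hz, ← Polynomial.count_roots, Polynomial.roots_C_mul _ hz0, Polynomial.roots_pow,
      Multiset.count_nsmul, Polynomial.count_roots]
  refine ⟨x, h.w_pos, h.topW.hasCorner_translate hω x, hmult ▸ h.topG.hasCorner_translate h.ψ_ne x,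
    (h.topZ.hasCorner_translate h.ζ_ne x).eq_zero,
    (h.topZ.hasCorner_translate h.ζ_ne x).coeff_ne_zero, hV, ?_, hx⟩
  rw [← map_aeval_of_fix _ (translate_C_C x), ← map_add, bracket_translate, h.bracket_eq, map_mul,
    translate_C_C, translate_T]

/-- Following a branch until the next edge of one of the Newton polygons produces a new branch
state. Its top coefficient `ω` is not a monomial, and if the edge has a multiple root then the
slope is an integer, so that `w` has become smaller. -/
theorem BranchCorner.exists_branchState {K ν : ℕ} (ha : 0 < a) (hab : Nat.Coprime a b)
    (hα : α.Monic) (hdeg : α.natDegree = a * δ)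
    (h : BranchCorner a b δ α W G Z w V ε K ν c) :
    ∃ W' G' Z' w' V' ε' ω ψ ζ c', BranchState a b δ α W' G' Z' w' V' ε' ω ψ ζ c' ∧
      ω.natDegree = K ∧ (∃ j < K, ω.coeff j ≠ 0) ∧ (ω.coeff (K - 1) ≠ 0 → w' < w) := by
  have hν : ν < a * δ * K := by
    have h1 := h.unbalanced.1
    have h2 : ((a : ℤ) - 1) * δ * K ≤ a * δ * K := by
      have : (0 : ℤ) ≤ δ * K := by positivity
      linarith
    exact_mod_cast h1.trans_le h2
  have hK : 0 < K := by
    rcases Nat.eq_zero_or_pos K with h0 | h0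
    · rw [h0] at hν; simp at hν
    · exact h0
  set S : Finset ℚ := slopes W w K ∪ slopes G (b * δ * w) (b * δ * K) ∪
    slopes Z (a * δ * w) (a * δ * K) with hS
  have hSne : S.Nonempty :=
    ⟨_, Finset.mem_union_right _ (mem_slopes.2 ⟨V, ν, hν, h.coeffZ, rfl⟩)⟩
  set s := S.min' hSne with hsdef
  have hsS : s ∈ S := S.min'_mem hSne
  have hsW : ∀ t ∈ slopes W w K, s ≤ t := fun t ht =>
    S.min'_le t (Finset.mem_union_left _ (Finset.mem_union_left _ ht))
  have hsG : ∀ t ∈ slopes G (b * δ * w) (b * δ * K), s ≤ t := fun t ht =>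
    S.min'_le t (Finset.mem_union_left _ (Finset.mem_union_right _ ht))
  have hsZ : ∀ t ∈ slopes Z (a * δ * w) (a * δ * K), s ≤ t := fun t ht =>
    S.min'_le t (Finset.mem_union_right _ ht)
  have hZ0 : ∀ i, (a * δ * w : ℤ) < i → Z.coeff i = 0 := fun i hi => h.topZ i (h.V_lt.trans hi)
  have hs0 : 0 < s := by
    rcases Finset.mem_union.1 hsS with h' | h'
    · rcases Finset.mem_union.1 h' with h' | h'
      · exact pos_of_mem_slopes h.cornerW h'
      · exact pos_of_mem_slopes h.cornerG h'
    · exact pos_of_mem_slopes_of_lt h.topZ h.V_lt h'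
  clear_value s
  have hp : 0 < s.num := Rat.num_pos.2 hs0
  have hq : (0 : ℤ) < s.den := by exact_mod_cast s.den_pos
  set p := s.num with hpdef
  set q : ℤ := ((s.den : ℕ) : ℤ) with hqdef
  -- the positivity of the new degree of `W` follows from the position of the vertex of `Z`
  have hZv := scale_le hZ0 hs0 hsZ h.coeffZ
  rw [← hpdef, ← hqdef] at hZv
  have hw' : 0 < q * w - p * K := by
    by_contra hneg
    have h2 := mul_pos hq h.unbalanced.2.1
    have hKz : (0 : ℤ) < K := by exact_mod_cast hK
    have h3 := mul_le_mul_of_nonneg_right hZv hKz.le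
    have hν' : (ν : ℤ) ≤ a * δ * K := by exact_mod_cast hν.le
    have h4 : (p * K - q * w) * ((ν : ℤ) - a * δ * K) ≤ 0 :=
      mul_nonpos_of_nonneg_of_nonpos (by linarith) (by linarith)
    push_cast at h3
    linarith
  have eG : q * (b * δ * w) - p * ((b * δ * K : ℕ) : ℤ) = b * δ * (q * w - p * K) := by
    push_cast; ring
  have eZ : q * (a * δ * w) - p * ((a * δ * K : ℕ) : ℤ) = a * δ * (q * w - p * K) := by
    push_cast; ring
  have hqne : q ≠ 0 := hq.ne'
  have tW := hasTop_scale h.cornerW.eq_zero hs0 hsW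
  have tG := hasTop_scale h.cornerG.eq_zero hs0 hsG
  have tZ := hasTop_scale hZ0 hs0 hsZ
  have dW := natDegree_coeff_scale h.cornerW hs0
  have dG := natDegree_coeff_scale h.cornerG hs0
  have cG : ((scale q p G).coeff (q * (b * δ * w) - p * ((b * δ * K : ℕ) : ℤ))).coeff
      (b * δ * K) ≠ 0 := by
    rw [coeff_scale hqne]; exact h.cornerG.coeff_ne_zero
  rw [← hpdef, ← hqdef] at tW tG tZ dW dG
  rw [eG] at tG dG cG
  rw [eZ] at tZ
  have cZ : ((scale q p Z).coeff (q * V - p * ν)).coeff ν ≠ 0 := by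
    rw [coeff_scale hqne]; exact h.coeffZ
  obtain ⟨V', ζ, hζ, hV'⟩ := exists_hasTop (A := scale q p Z) (by
    intro h0
    rw [h0] at cZ
    simp at cZ)
  have hVle : V' ≤ a * δ * (q * w - p * K) := by
    by_contra hlt
    exact hζ (hV'.2.symm.trans (tZ.1 V' (not_le.1 hlt)))
  have hVge : q * V - p * ν ≤ V' := by
    by_contra hlt
    rw [hV'.1 _ (not_le.1 hlt)] at cZ
    simp at cZ
  have hνle : ζ.natDegree ≤ ν := by
    rw [Polynomial.natDegree_le_iff_coeff_eq_zero]
    intro j hj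
    by_contra hne
    rw [← hV'.2] at hne
    obtain ⟨i, hi⟩ := exists_of_coeff_scale_ne_zero hne
    rw [hi, coeff_scale hqne] at hne
    have hiV : i ≤ V := by
      by_contra hlt
      rw [h.topZ i (not_le.1 hlt)] at hne
      simp at hne
    have e1 : q * i ≤ q * V := mul_le_mul_of_nonneg_left hiV hq.le
    have e2 : p * (ν : ℤ) < p * j := mul_lt_mul_of_pos_left (by exact_mod_cast hj) hp
    linarith
  set ω := (scale q p W).coeff (q * w - p * K) with hω
  set ψ := (scale q p G).coeff (b * δ * (q * w - p * K)) with hψ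
  have hunb : Unbalanced a b δ (q * w - p * K) V' (q * ε - p) ω.natDegree ζ.natDegree := by
    have hνz : (ζ.natDegree : ℤ) ≤ ν := by exact_mod_cast hνle
    refine (h.unbalanced.rescale hq p).mono ha dW ?_ ?_
    · exact lt_of_le_of_lt hνz h.unbalanced.1
    · have e1 := mul_le_mul_of_nonneg_right hVge (Int.natCast_nonneg K)
      have e2 := mul_le_mul_of_nonneg_left hνz hw'.le
      linarith
  have hbr : bracket (Polynomial.aeval (scale q p W) α + scale q p Z) (scale q p G) =
      LaurentPolynomial.C (Polynomial.C ((q : ℂ) * c)) * LaurentPolynomial.T (q * ε - p) := by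
    rw [← map_aeval_of_fix _ (scale_C_C q p), ← map_add, bracket_scale, h.bracket_eq, map_mul,
      scale_C_C, scale_T, sub_eq_add_neg, LaurentPolynomial.T_add]
    simp only [map_mul, map_intCast]
    ring
  have hst : BranchState a b δ α (scale q p W) (scale q p G) (scale q p Z) (q * w - p * K) V'
      (q * ε - p) ω ψ ζ ((q : ℂ) * c) :=
    ⟨hw', tW, tG, hV', fun h0 => by rw [h0] at cG; simp at cG, hζ, hVle, hbr, hunb⟩
  refine ⟨_, _, _, _, _, _, ω, ψ, ζ, _, hst, dW, ?_, ?_⟩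
  · obtain ⟨hVlt, z, hz⟩ := hst.rigid ha hab hα hdeg
    rcases Finset.mem_union.1 hsS with h' | h'
    · rcases Finset.mem_union.1 h' with h' | h'
      · exact exists_coeff_scale_of_mem h'
      · -- an edge of the polygon of `G` is also one of the polygon of `W`
        obtain ⟨j, hj, hne⟩ := exists_coeff_scale_of_mem h'
        rw [← hpdef, ← hqdef, eG, ← hψ, hz] at hne
        by_contra hno
        push Not at hno
        apply hne
        have hmon : ω = Polynomial.monomial K (ω.coeff K) := by
          ext i
          rw [Polynomial.coeff_monomial]
          rcases lt_trichotomy i K with hi | hi | hi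
          · rw [hno i hi, if_neg hi.ne']
          · rw [hi, if_pos rfl]
          · rw [Polynomial.coeff_eq_zero_of_natDegree_lt (dW.trans_lt hi), if_neg hi.ne]
        rw [hmon, Polynomial.monomial_pow, Polynomial.C_mul_monomial, Polynomial.coeff_monomial,
          if_neg]
        rw [mul_comm K]
        exact hj.ne'
    · exfalso
      obtain ⟨j, hj, hne⟩ := exists_coeff_scale_of_mem h'
      rw [← hpdef, ← hqdef, eZ, hV'.1 _ hVlt] at hne
      simp at hne
  · -- adjacent exponents at the edge force the slope to be an integer
    intro hne
    rw [hω] at hne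
    obtain ⟨i, hi⟩ := exists_of_coeff_scale_ne_zero hne
    have hpq : p = q * (w - i) := by
      have : ((K - 1 : ℕ) : ℤ) = K - 1 := by push_cast [hK]; ring
      rw [this] at hi
      linarith
    have hq1 : q = 1 := by
      have hco := s.reduced
      have hdvd : s.den ∣ s.num.natAbs := by
        rw [← Int.natCast_dvd]
        exact ⟨_, hpq⟩
      have := Nat.eq_one_of_dvd_coprimes hco hdvd dvd_rfl
      rw [hqdef, this]; rfl
    rw [hq1]
    have : 0 < p * (K : ℤ) := mul_pos hp (by exact_mod_cast hK)
    linarith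

/-- There is no branch at infinity along which `Z` lies below the ray through `W` as required by
`Unbalanced`: along such a branch the multiplicity `K`, or for constant `K` the degree `w`, would
decrease forever. -/
theorem BranchCorner.false (ha : 0 < a) (hb : 0 < b) (hab : Nat.Coprime a b) (hα : α.Monic)
    (hdeg : α.natDegree = a * δ) {K ν : ℕ} (h : BranchCorner a b δ α W G Z w V ε K ν c) :
    False := by
  induction K using Nat.strong_induction_on generalizing W G Z w V ε ν c with
  | _ K ihK =>
    obtain ⟨n, hn⟩ : ∃ n : ℕ, w.toNat = n := ⟨_, rfl⟩
    induction n using Nat.strong_induction_on generalizing W G Z w V ε ν c with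
    | _ n ihn =>
      obtain ⟨W', G', Z', w', V', ε', ω, ψ, ζ, c', hst, hωK, ⟨j, hj, hne⟩, hlt⟩ :=
        h.exists_branchState ha hab hα hdeg
      obtain ⟨x, hx⟩ := hst.exists_branchCorner ha hb hab hα hdeg
      have hω : ω ≠ 0 := by
        rintro rfl
        exact lt_irrefl _ hst.natDegree_pos.2
      have hle : ω.rootMultiplicity x ≤ K := by
        rw [← hωK, ← Polynomial.count_roots]
        exact (Multiset.count_le_card _ _).trans (Polynomial.card_roots' _)
      rcases hle.lt_or_eq with hlt' | heq
      · exact ihK _ hlt' hx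
      · -- all roots of `ω` coincide
        obtain ⟨r, hr, -⟩ := Polynomial.exists_eq_pow_rootMultiplicity_mul_and_not_dvd ω hω x
        rw [heq] at hr
        have hr0 : r ≠ 0 := by
          rintro rfl
          exact hω (by rw [hr, mul_zero])
        have hrdeg : r.natDegree = 0 := by
          have := congrArg Polynomial.natDegree hr
          rw [Polynomial.natDegree_mul (pow_ne_zero _ (Polynomial.X_sub_C_ne_zero x)) hr0,
            Polynomial.natDegree_pow, Polynomial.natDegree_X_sub_C, hωK] at this
          omega
        obtain ⟨z, rfl⟩ : ∃ z, r = Polynomial.C z := ⟨_, Polynomial.eq_C_of_natDegree_eq_zero hrdeg⟩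
        have hz : z ≠ 0 := by
          rintro rfl
          simp at hr0
        have hcoef : ∀ i, ω.coeff i = (-x) ^ (K - i) * (K.choose i : ℂ) * z := by
          intro i
          rw [hr, Polynomial.coeff_mul_C, sub_eq_add_neg, ← Polynomial.C_neg, Polynomial.coeff_X_add_C_pow]
        have hx0 : -x ≠ 0 := by
          intro h0
          rw [hcoef, h0, zero_pow (by omega)] at hne
          simp at hne
        have hww : w' < w := by
          apply hlt
          rw [hcoef]
          refine mul_ne_zero (mul_ne_zero (pow_ne_zero _ hx0) ?_) hz
          exact_mod_cast (Nat.choose_pos (by omega)).ne'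
        have hw0 := hst.w_pos
        rw [heq] at hx
        exact ihn w'.toNat (by omega) hx rfl

theorem BranchState.false {ω ψ ζ : ℂ[X]} (ha : 0 < a) (hb : 0 < b) (hab : Nat.Coprime a b)
    (hα : α.Monic) (hdeg : α.natDegree = a * δ)
    (h : BranchState a b δ α W G Z w V ε ω ψ ζ c) : False := by
  obtain ⟨x, hx⟩ := h.exists_branchCorner ha hb hab hα hdeg
  exact hx.false ha hb hab hα hdeg

/-! ### Polynomials in two variables as Laurent polynomials -/

theorem expo_eq_iff {i j : ℕ} {s : Fin 2 →₀ ℕ} : expo i j = s ↔ i = s 0 ∧ j = s 1 := by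
  constructor
  · rintro rfl; simp [expo]
  · rintro ⟨rfl, rfl⟩
    ext k
    fin_cases k <;> simp [expo]

theorem expo_self (s : Fin 2 →₀ ℕ) : expo (s 0) (s 1) = s := expo_eq_iff.2 ⟨rfl, rfl⟩

theorem coeffXY_monomial (s : Fin 2 →₀ ℕ) (c : ℂ) (i j : ℕ) :
    coeffXY i j (MvPolynomial.monomial s c) = if i = s 0 ∧ j = s 1 then c else 0 := by
  rw [coeffXY, MvPolynomial.coeff_monomial]
  exact if_congr (eq_comm.trans expo_eq_iff) rfl rfl

theorem coeffXY_add (i j : ℕ) (f g : Poly) : coeffXY i j (f + g) = coeffXY i j f + coeffXY i j g :=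
  MvPolynomial.coeff_add _ _ _

theorem coeffXY_sub (i j : ℕ) (f g : Poly) : coeffXY i j (f - g) = coeffXY i j f - coeffXY i j g :=
  MvPolynomial.coeff_sub _ _ _ _

theorem coeffXY_C_mul (i j : ℕ) (c : ℂ) (f : Poly) :
    coeffXY i j (MvPolynomial.C c * f) = c * coeffXY i j f :=
  MvPolynomial.coeff_C_mul _ _ _

theorem Poly.ext {f g : Poly} (h : ∀ i j, coeffXY i j f = coeffXY i j g) : f = g := by
  apply MvPolynomial.ext
  intro s
  have := h (s 0) (s 1)
  rwa [coeffXY, coeffXY, expo_self] at this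

/-- The inclusion of `ℂ[x, y]` into `ℂ[u][x, x⁻¹]`, with `u = y`. -/
noncomputable def embed : Poly →+* LPoly :=
  MvPolynomial.eval₂Hom (LaurentPolynomial.C.comp Polynomial.C)
    ![LaurentPolynomial.T 1, LaurentPolynomial.C Polynomial.X]

theorem embed_monomial (s : Fin 2 →₀ ℕ) (c : ℂ) : embed (MvPolynomial.monomial s c) =
    LaurentPolynomial.C (Polynomial.monomial (s 1) c) * LaurentPolynomial.T (s 0 : ℤ) := by
  rw [embed, MvPolynomial.coe_eval₂Hom, MvPolynomial.eval₂_monomial,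
    Finsupp.prod_fintype _ _ (fun i => pow_zero _), Fin.prod_univ_two,
    ← Polynomial.C_mul_X_pow_eq_monomial]
  simp only [Matrix.cons_val_zero, Matrix.cons_val_one, LaurentPolynomial.T_pow, map_mul, map_pow,
    RingHom.comp_apply, mul_one]
  ring

theorem coeff_embed (f : Poly) (i j : ℕ) : ((embed f).coeff (i : ℤ)).coeff j = coeffXY i j f := by
  induction f using MvPolynomial.induction_on' with
  | monomial s c =>
    rw [embed_monomial, coeff_monomial_mul_T, coeffXY_monomial]
    by_cases h0 : s 0 = i
    · rw [if_pos (by exact_mod_cast h0), Polynomial.coeff_monomial]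
      by_cases h1 : s 1 = j
      · rw [if_pos h1, if_pos ⟨h0.symm, h1.symm⟩]
      · rw [if_neg h1, if_neg fun h => h1 h.2.symm]
    · rw [if_neg (by exact_mod_cast h0), if_neg fun h => h0 h.1.symm, Polynomial.coeff_zero]
  | add p q hp hq =>
    rw [map_add, coeffXY_add, ← hp, ← hq]; rfl

theorem coeff_embed_of_neg (f : Poly) {i : ℤ} (hi : i < 0) : (embed f).coeff i = 0 := by
  induction f using MvPolynomial.induction_on' with
  | monomial s c =>
    rw [embed_monomial, coeff_monomial_mul_T, if_neg]
    omega
  | add p q hp hq =>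
    rw [map_add, AddMonoidAlgebra.coeff_add, Finsupp.add_apply, hp, hq, add_zero]

theorem embed_injective : Function.Injective embed := by
  intro f g h
  apply Poly.ext
  intro i j
  rw [← coeff_embed, ← coeff_embed, h]

theorem embed_aeval (W : Poly) (α : ℂ[X]) :
    embed (Polynomial.aeval W α) = Polynomial.aeval (embed W) α := by
  rw [Polynomial.aeval_def, Polynomial.aeval_def, Polynomial.hom_eval₂]
  congr 1
  ext1 z
  exact MvPolynomial.eval₂Hom_C _ _ _

theorem xDeriv_embed (f : Poly) :
    xDeriv (embed f) = LaurentPolynomial.T 1 * embed (MvPolynomial.pderiv 0 f) := by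
  induction f using MvPolynomial.induction_on' with
  | monomial s c =>
    rw [MvPolynomial.pderiv_monomial, embed_monomial, embed_monomial, xDeriv_monomial,
      LaurentPolynomial.T_mul, mul_assoc, ← LaurentPolynomial.T_add]
    rcases hs : s 0 with _ | k
    · simp
    · have e1 : (s - Finsupp.single 0 1 : Fin 2 →₀ ℕ) 1 = s 1 := by simp
      have e2 : (((s - Finsupp.single 0 1 : Fin 2 →₀ ℕ) 0 : ℕ) : ℤ) + 1 = ((k + 1 : ℕ) : ℤ) := by
        simp [hs]
      rw [e1, e2]
      congr 2
      rw [Int.cast_natCast, ← Polynomial.C_eq_natCast, Polynomial.C_mul_monomial, mul_comm]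
  | add p q hp hq => simp only [map_add, hp, hq, mul_add]

theorem uDeriv_embed (f : Poly) : uDeriv (embed f) = embed (MvPolynomial.pderiv 1 f) := by
  induction f using MvPolynomial.induction_on' with
  | monomial s c =>
    rw [MvPolynomial.pderiv_monomial, embed_monomial, embed_monomial, uDeriv_monomial,
      Polynomial.derivative_monomial]
    have e1 : (s - Finsupp.single 1 1 : Fin 2 →₀ ℕ) 0 = s 0 := by simp
    have e2 : (s - Finsupp.single 1 1 : Fin 2 →₀ ℕ) 1 = s 1 - 1 := by simp
    rw [e1, e2]
  | add p q hp hq => simp only [map_add, hp, hq]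

theorem jac_eq (f g : Poly) : jac f g = MvPolynomial.pderiv 0 f * MvPolynomial.pderiv 1 g -
    MvPolynomial.pderiv 0 g * MvPolynomial.pderiv 1 f := by
  rw [jac, Matrix.det_fin_two_of]

theorem bracket_embed (f g : Poly) :
    bracket (embed f) (embed g) = LaurentPolynomial.T 1 * embed (jac f g) := by
  rw [bracket, xDeriv_embed, xDeriv_embed, uDeriv_embed, uDeriv_embed, jac_eq, map_sub, map_mul,
    map_mul]
  ring

theorem embed_C (c : ℂ) : embed (MvPolynomial.C c) = LaurentPolynomial.C (Polynomial.C c) :=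
  MvPolynomial.eval₂Hom_C _ _ _

/-- The monomials of `f` are contained in the rectangle with upper right corner `(m, n)`. -/
def InBox (f : Poly) (m n : ℕ) : Prop := ∀ i j, coeffXY i j f ≠ 0 → i ≤ m ∧ j ≤ n

/-- The coefficient of `x ^ m` in `f`, as a polynomial in `y`. -/
noncomputable def xCoeff (f : Poly) (m : ℕ) : ℂ[X] := (embed f).coeff (m : ℤ)

theorem coeff_xCoeff (f : Poly) (i j : ℕ) : (xCoeff f i).coeff j = coeffXY i j f :=
  coeff_embed f i j

theorem hasTop_embed {f : Poly} {m : ℕ} (h : ∀ i j, coeffXY i j f ≠ 0 → i ≤ m) :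
    HasTop (embed f) m (xCoeff f m) := by
  refine ⟨fun i hi => ?_, rfl⟩
  lift i to ℕ using (by omega)
  ext j
  rw [coeff_embed, Polynomial.coeff_zero]
  by_contra hne
  have := h i j hne
  omega

theorem le_of_hasTop {f : Poly} {m : ℕ} {p : ℂ[X]} (h : HasTop (embed f) m p) {i j : ℕ}
    (hij : coeffXY i j f ≠ 0) : i ≤ m := by
  by_contra hlt
  rw [← coeff_embed, h.1 _ (by exact_mod_cast not_le.1 hlt)] at hij
  simp at hij

theorem natDegree_xCoeff {f : Poly} {m n : ℕ} (h : InBox f m n) (hc : coeffXY m n f ≠ 0) :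
    (xCoeff f m).natDegree = n := by
  apply le_antisymm
  · rw [Polynomial.natDegree_le_iff_coeff_eq_zero]
    intro j hj
    by_contra hne
    rw [coeff_xCoeff] at hne
    exact absurd (h m j hne).2 (not_le.2 hj)
  · apply Polynomial.le_natDegree_of_ne_zero
    rwa [coeff_xCoeff]

theorem xCoeff_ne_zero {f : Poly} {i j : ℕ} (hc : coeffXY i j f ≠ 0) : xCoeff f i ≠ 0 := by
  intro h0
  rw [← coeff_xCoeff, h0] at hc
  simp at hc

/-- The right edge of the Newton polygon of `Z` does not end below the diagonal. -/
theorem EN_le_diagonal {a b δ M N : ℕ} (ha : 0 < a) (hb : 0 < b)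
    (hab : Nat.Coprime a b) (hM : 0 < M) {α : ℂ[X]} (hα : α.Monic)
    (hdeg : α.natDegree = a * δ) {W G Z : Poly} (hW : InBox W M N) (hWc : coeffXY M N W ≠ 0)
    (hG : InBox G (b * δ * M) (b * δ * N)) (hGc : coeffXY (b * δ * M) (b * δ * N) G ≠ 0)
    (hZ : InBox Z (a * δ * M) (a * δ * N))
    (hZc : ∀ i j, coeffXY i j Z ≠ 0 → i < (a - 1) * δ * M ∨ j < (a - 1) * δ * N) {c : ℂ}
    (hjac : jac (Polynomial.aeval W α + Z) G = MvPolynomial.C c)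
    (hsize : (a : ℤ) * δ * (N - M) ≤ a + b - 1)
    {V ν : ℕ} (hV : coeffXY V ν Z ≠ 0) (hVi : ∀ i j, coeffXY i j Z ≠ 0 → i ≤ V)
    (hVj : ∀ j, coeffXY V j Z ≠ 0 → j ≤ ν) : N * V ≤ M * ν := by
  by_contra hlt
  rw [not_le] at hlt
  have hν : (xCoeff Z V).natDegree = ν := by
    apply le_antisymm
    · rw [Polynomial.natDegree_le_iff_coeff_eq_zero]
      intro j hj
      by_contra hne
      rw [coeff_xCoeff] at hne
      exact absurd (hVj j hne) (not_le.2 hj)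
    · apply Polynomial.le_natDegree_of_ne_zero
      rwa [coeff_xCoeff]
  have hX : (1 : ℤ) ≤ V * N - M * ν := by
    have : (M * ν : ℤ) < N * V := by exact_mod_cast hlt
    linarith
  have hν' : ν < (a - 1) * δ * N := by
    rcases hZc V ν hV with h | h
    · have h1 : N * V ≤ N * ((a - 1) * δ * M) := Nat.mul_le_mul_left _ h.le
      have h2 : M * ν < M * ((a - 1) * δ * N) := by
        calc M * ν < N * V := hlt
          _ ≤ N * ((a - 1) * δ * M) := h1
          _ = M * ((a - 1) * δ * N) := by ring
      exact lt_of_mul_lt_mul_left h2 (Nat.zero_le _)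
    · exact h
  have hδN : 0 < δ * N := by
    rcases Nat.eq_zero_or_pos (δ * N) with h0 | h0
    · rw [mul_assoc, h0] at hν'; simp at hν'
    · exact h0
  have hδ : 0 < δ := Nat.pos_of_mul_pos_right hδN
  have hst : BranchState a b δ α (embed W) (embed G) (embed Z) M V 1 (xCoeff W M)
      (xCoeff G (b * δ * M)) (xCoeff Z V) c := by
    refine ⟨by exact_mod_cast hM, hasTop_embed fun i j h => (hW i j h).1, ?_, hasTop_embed hVi,
      xCoeff_ne_zero hGc, xCoeff_ne_zero hV, by exact_mod_cast (hZ V ν hV).1, ?_, ?_⟩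
    · exact_mod_cast hasTop_embed fun i j h => (hG i j h).1
    · rw [← embed_aeval, ← map_add, bracket_embed, hjac, embed_C, mul_comm]
    · rw [natDegree_xCoeff hW hWc, hν]
      refine ⟨by zify [ha] at hν'; exact hν', by linarith, ?_⟩
      rw [mul_one]
      have ha' : (0 : ℤ) < a := by exact_mod_cast ha
      have hs : (0 : ℤ) < a + b - 1 := by omega
      have hXs : ((a : ℤ) + b - 1) * 1 ≤ (a + b - 1) * (V * N - M * ν) :=
        mul_le_mul_of_nonneg_left hX hs.le
      rcases le_or_gt (N : ℤ) M with hNM | hNM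
      · left
        have : (a : ℤ) * (N - M) ≤ 0 :=
          mul_nonpos_of_nonneg_of_nonpos ha'.le (by linarith)
        linarith
      · have h1 : (a : ℤ) * (N - M) ≤ a * δ * (N - M) := by
          have hd1 : (1 : ℤ) ≤ δ := by exact_mod_cast hδ
          have h2 : 0 ≤ (a : ℤ) * (N - M) * (δ - 1) :=
            mul_nonneg (mul_nonneg ha'.le (by linarith)) (by linarith)
          linarith
        have hδN2 : 2 ≤ δ * N := by
          have hN : 2 ≤ N := by omega
          exact hN.trans (Nat.le_mul_of_pos_left _ hδ)
        rcases ((h1.trans hsize).trans ((mul_one _).symm.le.trans hXs)).lt_or_eq with h | h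
        · exact Or.inl h
        · exact Or.inr ⟨h, hδN2⟩
  exact hst.false ha hb hab hα hdeg

/-! ### Exchanging the variables -/

/-- The automorphism of `ℂ[x, y]` that exchanges `x` and `y`. -/
noncomputable def swapXY : Poly →ₐ[ℂ] Poly := MvPolynomial.rename (Equiv.swap 0 1)

theorem coeffXY_swapXY (f : Poly) (i j : ℕ) : coeffXY i j (swapXY f) = coeffXY j i f := by
  have : expo i j = (expo j i).mapDomain (Equiv.swap (0 : Fin 2) 1) := by
    rw [expo, expo, Finsupp.mapDomain_add, Finsupp.mapDomain_single, Finsupp.mapDomain_single,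
      Equiv.swap_apply_left, Equiv.swap_apply_right, add_comm]
  rw [coeffXY, coeffXY, swapXY, this,
    MvPolynomial.coeff_rename_mapDomain _ (Equiv.injective _)]

theorem swapXY_aeval (W : Poly) (α : ℂ[X]) :
    swapXY (Polynomial.aeval W α) = Polynomial.aeval (swapXY W) α :=
  (Polynomial.aeval_algHom_apply swapXY W α).symm

theorem jac_swapXY (f g : Poly) : jac (swapXY f) (swapXY g) = - swapXY (jac f g) := by
  have h0 : ∀ f : Poly, MvPolynomial.pderiv 0 (swapXY f) = swapXY (MvPolynomial.pderiv 1 f) := by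
    intro f
    have := MvPolynomial.pderiv_rename (R := ℂ) (Equiv.injective (Equiv.swap (0 : Fin 2) 1)) 1 f
    rwa [Equiv.swap_apply_right] at this
  have h1 : ∀ f : Poly, MvPolynomial.pderiv 1 (swapXY f) = swapXY (MvPolynomial.pderiv 0 f) := by
    intro f
    have := MvPolynomial.pderiv_rename (R := ℂ) (Equiv.injective (Equiv.swap (0 : Fin 2) 1)) 0 f
    rwa [Equiv.swap_apply_left] at this
  rw [jac_eq, jac_eq, h0, h0, h1, h1, map_sub, map_mul, map_mul]
  ring

theorem swapXY_C (c : ℂ) : swapXY (MvPolynomial.C c) = MvPolynomial.C c := by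
  rw [swapXY, MvPolynomial.rename_C]

theorem InBox.swapXY {f : Poly} {m n : ℕ} (h : InBox f m n) : InBox (swapXY f) n m := by
  intro i j hij
  rw [coeffXY_swapXY] at hij
  exact (h j i hij).symm

/-! ### Newton polygons that are rectangles -/

theorem rect_eq_Icc (m n : ℕ) :
    rect m n = Set.Icc (0 : ℝ) m ×ˢ Set.Icc (0 : ℝ) n := by
  have h : ({((0 : ℝ), (0 : ℝ)), ((m : ℝ), (0 : ℝ)), ((m : ℝ), (n : ℝ)), ((0 : ℝ), (n : ℝ))} :
      Set (ℝ × ℝ)) = {(0 : ℝ), (m : ℝ)} ×ˢ {(0 : ℝ), (n : ℝ)} := by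
    ext ⟨p, q⟩
    simp only [Set.mem_insert_iff, Set.mem_singleton_iff, Prod.mk.injEq, Set.mem_prod]
    tauto
  rw [rect, h, convexHull_prod, convexHull_pair, convexHull_pair,
    segment_eq_Icc (Nat.cast_nonneg m), segment_eq_Icc (Nat.cast_nonneg n)]

theorem mem_rect_iff {m n i j : ℕ} : ((i : ℝ), (j : ℝ)) ∈ rect m n ↔ i ≤ m ∧ j ≤ n := by
  rw [rect_eq_Icc, Set.mem_prod, Set.mem_Icc, Set.mem_Icc]
  simp

theorem extremePoint_rect (m n : ℕ) {p : ℝ × ℝ} (h1 : p.1 = 0 ∨ p.1 = m) (h2 : p.2 = 0 ∨ p.2 = n) :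
    p ∈ (rect m n).extremePoints ℝ := by
  have key : ∀ (k : ℕ) (t : ℝ), t = 0 ∨ t = k → t ∈ (Set.Icc (0 : ℝ) k).extremePoints ℝ := by
    intro k t ht
    refine ⟨?_, ?_⟩
    · rcases ht with rfl | rfl <;> simp
    · rintro x ⟨hx1, hx2⟩ y ⟨hy1, hy2⟩ ⟨c, d, hc, hd, hcd, rfl⟩
      simp only [smul_eq_mul] at ht ⊢
      rcases ht with h | h
      · have e1 : 0 ≤ c * x := mul_nonneg hc.le hx1
        have e2 : 0 ≤ d * y := mul_nonneg hd.le hy1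
        have e3 : c * x = 0 := by linarith
        have e4 : x = 0 := (mul_eq_zero.1 e3).resolve_left hc.ne'
        rw [h, e4]
      · have e1 : 0 ≤ c * (k - x) := mul_nonneg hc.le (by linarith)
        have e2 : 0 ≤ d * (k - y) := mul_nonneg hd.le (by linarith)
        have e5 : c * (k - x) + d * (k - y) = 0 := by
          have : c * (k : ℝ) + d * k = k := by rw [← add_mul, hcd, one_mul]
          linarith
        have e3 : c * ((k : ℝ) - x) = 0 := by linarith
        have e4 : (k : ℝ) - x = 0 := (mul_eq_zero.1 e3).resolve_left hc.ne'
        rw [h]; linarith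
  rw [rect_eq_Icc, extremePoints_prod]
  exact ⟨key m _ h1, key n _ h2⟩

theorem mem_augNewton {f : Poly} {i j : ℕ} (h : coeffXY i j f ≠ 0) :
    ((i : ℝ), (j : ℝ)) ∈ augNewton f :=
  subset_convexHull ℝ _ (Or.inl ⟨i, j, h, rfl⟩)

theorem InBox.augNewton_subset {f : Poly} {m n : ℕ} (h : InBox f m n) :
    augNewton f ⊆ rect m n := by
  apply convexHull_min
  · rintro p (⟨i, j, hij, rfl⟩ | hp)
    · exact mem_rect_iff.2 (h i j hij)
    · rw [Set.mem_singleton_iff] at hp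
      subst hp
      exact_mod_cast mem_rect_iff.2 ⟨Nat.zero_le m, Nat.zero_le n⟩
  · exact convex_convexHull ℝ _

theorem mem_rectPoly_iff {f : Poly} {m n : ℕ} (hm : 0 < m) (hn : 0 < n) : f ∈ rectPoly m n ↔
    InBox f m n ∧ coeffXY m n f = 1 ∧ coeffXY m 0 f ≠ 0 ∧ coeffXY 0 n f ≠ 0 := by
  constructor
  · rintro ⟨h1, h2⟩
    have hvert : ∀ i j : ℕ, (i = 0 ∨ i = m) → (j = 0 ∨ j = n) → ¬ (i = 0 ∧ j = 0) →
        coeffXY i j f ≠ 0 := by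
      intro i j hi hj hij
      have hmem : ((i : ℝ), (j : ℝ)) ∈ (augNewton f).extremePoints ℝ := by
        rw [h1]
        refine extremePoint_rect m n ?_ ?_
        · rcases hi with rfl | rfl <;> simp
        · rcases hj with rfl | rfl <;> simp
      rcases extremePoints_convexHull_subset hmem with ⟨i', j', h', he⟩ | h'
      · simp only [Prod.mk.injEq, Nat.cast_inj] at he
        rwa [he.1, he.2]
      · simp only [Set.mem_singleton_iff, Prod.mk.injEq, Nat.cast_eq_zero] at h'
        exact absurd h' hij
    refine ⟨fun i j hij => ?_, h2, ?_, ?_⟩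
    · have := mem_augNewton hij
      rw [h1] at this
      exact mem_rect_iff.1 this
    · exact hvert m 0 (Or.inr rfl) (Or.inl rfl) (by omega)
    · exact hvert 0 n (Or.inl rfl) (Or.inr rfl) (by omega)
  · rintro ⟨h1, h2, h3, h4⟩
    refine ⟨subset_antisymm h1.augNewton_subset (convexHull_min ?_ (convex_convexHull ℝ _)), h2⟩
    have h5 : coeffXY m n f ≠ 0 := by rw [h2]; exact one_ne_zero
    rintro p (rfl | rfl | rfl | rfl)
    · exact subset_convexHull ℝ _ (Or.inr rfl)
    · exact_mod_cast mem_augNewton h3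
    · exact mem_augNewton h5
    · exact_mod_cast mem_augNewton h4

/-- No monomial of `f` lies in the copy of the rectangle of size `A × B` in the upper right corner
of the rectangle of size `aA × aB`. -/
def OffCorner (a A B : ℕ) (f : Poly) : Prop :=
  ∀ i j, coeffXY i j f ≠ 0 → i < (a - 1) * A ∨ j < (a - 1) * B

theorem mem_cornerRect_iff {a A B i j : ℕ} (ha : 0 < a) :
    ((i : ℝ), (j : ℝ)) ∈ cornerRect a (a * A) (a * B) ↔
      ((a - 1) * A ≤ i ∧ i ≤ a * A) ∧ (a - 1) * B ≤ j ∧ j ≤ a * B := by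
  have ha' : (a : ℝ) ≠ 0 := by exact_mod_cast ha.ne'
  have e : ∀ X : ℕ, (((a : ℝ) - 1) / a) * ((a * X : ℕ) : ℝ) = (((a - 1) * X : ℕ) : ℝ) := by
    intro X
    push_cast [ha]
    field_simp
  have e' : ∀ X : ℕ, a * X = (a - 1) * X + X := by
    intro X
    obtain ⟨k, rfl⟩ := Nat.exists_eq_add_of_le' ha
    simp; ring
  simp only [cornerRect, Nat.mul_div_cancel_left _ ha, Set.mem_image, Prod.exists]
  constructor
  · rintro ⟨s, t, hst, h⟩
    rw [rect_eq_Icc, Set.mem_prod, Set.mem_Icc, Set.mem_Icc] at hst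
    simp only [Prod.smul_mk, smul_eq_mul, Prod.mk_add_mk, Prod.mk.injEq, e] at h
    obtain ⟨⟨h1, h2⟩, h3, h4⟩ := hst
    refine ⟨⟨?_, ?_⟩, ?_, ?_⟩
    · have : (((a - 1) * A : ℕ) : ℝ) ≤ i := by rw [← h.1]; linarith
      exact_mod_cast this
    · have : (i : ℝ) ≤ (((a - 1) * A + A : ℕ) : ℝ) := by rw [← h.1, Nat.cast_add]; linarith
      rw [e']; exact_mod_cast this
    · have : (((a - 1) * B : ℕ) : ℝ) ≤ j := by rw [← h.2]; linarith
      exact_mod_cast this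
    · have : (j : ℝ) ≤ (((a - 1) * B + B : ℕ) : ℝ) := by rw [← h.2, Nat.cast_add]; linarith
      rw [e']; exact_mod_cast this
  · rintro ⟨⟨h1, h2⟩, h3, h4⟩
    rw [e'] at h2 h4
    refine ⟨((i - (a - 1) * A : ℕ) : ℝ), ((j - (a - 1) * B : ℕ) : ℝ),
      mem_rect_iff.2 ⟨by omega, by omega⟩, ?_⟩
    simp only [Prod.smul_mk, smul_eq_mul, Prod.mk_add_mk, Prod.mk.injEq, e]
    constructor
    · rw [← Nat.cast_add]; congr 1; omega
    · rw [← Nat.cast_add]; congr 1; omega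

theorem supp_subset_iff {a A B : ℕ} (ha : 0 < a) {F f : Poly}
    (hF : augNewton F = rect (a * A) (a * B)) :
    supp f ⊆ augNewton F \ cornerRect a (a * A) (a * B) ↔
      InBox f (a * A) (a * B) ∧ OffCorner a A B f := by
  rw [hF]
  constructor
  · intro h
    have h' : ∀ i j, coeffXY i j f ≠ 0 → _ := fun i j hij => h ⟨i, j, hij, rfl⟩
    refine ⟨fun i j hij => mem_rect_iff.1 (h' i j hij).1, fun i j hij => ?_⟩
    have h1 := mem_rect_iff.1 (h' i j hij).1
    have h2 := (h' i j hij).2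
    rw [mem_cornerRect_iff ha] at h2
    by_contra hno
    push Not at hno
    exact h2 ⟨⟨hno.1, h1.1⟩, hno.2, h1.2⟩
  · rintro ⟨h1, h2⟩ p ⟨i, j, hij, rfl⟩
    refine ⟨mem_rect_iff.2 (h1 i j hij), ?_⟩
    rw [mem_cornerRect_iff ha]
    rintro ⟨⟨h3, -⟩, h4, -⟩
    rcases h2 i j hij with h | h <;> omega

theorem vertexProperty_of_inBox {m n M N : ℕ} (hm : 0 < m) {f : Poly} (h : InBox f M N)
    (hc : coeffXY M N f ≠ 0 ∨ M = 0 ∧ N = 0) (hdiag : n * M = m * N) : VertexProperty m n f := by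
  have hsub := h.augNewton_subset
  have hmem : ((M : ℝ), (N : ℝ)) ∈ augNewton f := by
    rcases hc with hc | ⟨rfl, rfl⟩
    · exact mem_augNewton hc
    · exact subset_convexHull ℝ _ (Or.inr (by simp))
  have hext : ((M : ℝ), (N : ℝ)) ∈ (augNewton f).extremePoints ℝ :=
    inter_extremePoints_subset_extremePoints_of_subset hsub
      ⟨hmem, extremePoint_rect M N (Or.inr rfl) (Or.inr rfl)⟩
  have hle : ∀ p ∈ (augNewton f).extremePoints ℝ, p.1 ≤ M ∧ p.2 ≤ N := by
    intro p hp
    have := hsub hp.1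
    rw [rect_eq_Icc] at this
    exact ⟨this.1.2, this.2.2⟩
  refine ⟨M, N, ⟨hext, fun p hp => ?_⟩, ⟨hext, fun p hp => ?_⟩, ?_, hsub⟩
  · rcases (hle p hp).2.lt_or_eq with h' | h'
    · exact Or.inl h'
    · exact Or.inr ⟨h', (hle p hp).1⟩
  · rcases (hle p hp).1.lt_or_eq with h' | h'
    · exact Or.inl h'
    · exact Or.inr ⟨h', (hle p hp).2⟩
  · have hm' : (m : ℝ) ≠ 0 := by exact_mod_cast hm.ne'
    have : (n : ℝ) * M = m * N := by exact_mod_cast hdiag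
    field_simp
    linarith

theorem exists_EN {f : Poly} (hf : f ≠ 0) : ∃ V ν, coeffXY V ν f ≠ 0 ∧
    (∀ i j, coeffXY i j f ≠ 0 → i ≤ V) ∧ ∀ j, coeffXY V j f ≠ 0 → j ≤ ν := by
  obtain ⟨M, p, hp, h⟩ := exists_hasTop (A := embed f) (by
    rwa [Ne, map_eq_zero_iff _ embed_injective])
  have hM : 0 ≤ M := by
    by_contra hlt
    exact hp (h.2.symm.trans (coeff_embed_of_neg f (not_le.1 hlt)))
  lift M to ℕ using hM
  refine ⟨M, p.natDegree, ?_, fun i j => le_of_hasTop h, fun j hj => ?_⟩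
  · rw [← coeff_embed, h.2]
    exact Polynomial.leadingCoeff_ne_zero.2 hp
  · rw [← coeff_embed, h.2] at hj
    exact Polynomial.le_natDegree_of_ne_zero hj

/-- If neither the right nor the upper edge of the Newton polygon of `Z` ends on the wrong side of
the diagonal, then both end in a common vertex on the diagonal. The hypothesis `M ≤ N` makes the
size condition void after the exchange of the variables. -/
theorem vertexProperty_of_jac {a b δ M N m n : ℕ} (ha : 0 < a) (hb : 0 < b)
    (hab : Nat.Coprime a b) (hM : 0 < M) (hMN : M ≤ N) (hm : m = a * δ * M) (hn : n = a * δ * N)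
    {α : ℂ[X]} (hα : α.Monic) (hdeg : α.natDegree = a * δ) (hδ : 0 < δ) {W G Z : Poly}
    (hW : InBox W M N) (hWc : coeffXY M N W ≠ 0)
    (hG : InBox G (b * δ * M) (b * δ * N)) (hGc : coeffXY (b * δ * M) (b * δ * N) G ≠ 0)
    (hZ : InBox Z m n) (hZc : OffCorner a (δ * M) (δ * N) Z) {c : ℂ}
    (hjac : jac (Polynomial.aeval W α + Z) G = MvPolynomial.C c)
    (hsize : (a : ℤ) * δ * (N - M) ≤ a + b - 1) : VertexProperty m n Z := by
  subst hm hn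
  have hN : 0 < N := hM.trans_le hMN
  have hm : 0 < a * δ * M := Nat.mul_pos (Nat.mul_pos ha hδ) hM
  by_cases hZ0 : Z = 0
  · exact vertexProperty_of_inBox (M := 0) (N := 0) hm (fun i j h => by simp [hZ0, coeffXY] at h)
      (Or.inr ⟨rfl, rfl⟩) (by simp)
  obtain ⟨V, ν, h1, h2, h3⟩ := exists_EN hZ0
  obtain ⟨H, U, h4, h5, h6⟩ := exists_EN (f := swapXY Z)
    fun h0 => hZ0 (MvPolynomial.rename_injective _ (Equiv.injective _) (h0.trans (map_zero _).symm))
  simp only [coeffXY_swapXY] at h4 h5 h6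
  have hEN : N * V ≤ M * ν := EN_le_diagonal ha hb hab hM hα hdeg hW hWc hG hGc hZ
    (fun i j hij => by simpa only [mul_assoc] using hZc i j hij) hjac hsize h1 h2 h3
  have hNE : M * H ≤ N * U := by
    refine EN_le_diagonal (c := -c) ha hb hab hN hα hdeg hW.swapXY ?_ hG.swapXY ?_ hZ.swapXY
      ?_ ?_ ?_ (Z := swapXY Z) ?_ ?_ ?_
    · rwa [coeffXY_swapXY]
    · rwa [coeffXY_swapXY]
    · intro i j hij
      rw [coeffXY_swapXY] at hij
      simpa only [mul_assoc] using (hZc j i hij).symm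
    · rw [← swapXY_aeval, ← map_add, jac_swapXY, hjac, swapXY_C, map_neg]
    · have : (a : ℤ) * δ * (M - N) ≤ 0 :=
        mul_nonpos_of_nonneg_of_nonpos (by positivity) (by
          have : (M : ℤ) ≤ N := by exact_mod_cast hMN
          linarith)
      omega
    · rwa [coeffXY_swapXY]
    · intro i j hij
      rw [coeffXY_swapXY] at hij
      exact h5 i j hij
    · intro j hij
      rw [coeffXY_swapXY] at hij
      exact h6 j hij
  have hUV : U ≤ V := h2 U H h4
  have hνH : ν ≤ H := h5 ν V h1
  have e1 : M * ν ≤ M * H := Nat.mul_le_mul_left _ hνH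
  have e2 : N * U ≤ N * V := Nat.mul_le_mul_left _ hUV
  have e3 : ν = H := Nat.eq_of_mul_eq_mul_left hM (by omega)
  refine vertexProperty_of_inBox (M := V) (N := ν) hm (fun i j hij => ⟨h2 i j hij, ?_⟩) (Or.inl h1) ?_
  · rw [e3]; exact h5 j i hij
  · have : N * V = M * ν := by omega
    rw [mul_assoc, this]; ring

/-! ### Products and leading corners -/

theorem exists_of_coeffXY_mul_ne_zero {f g : Poly} {i j : ℕ} (h : coeffXY i j (f * g) ≠ 0) :
    ∃ i₁ j₁ i₂ j₂, i = i₁ + i₂ ∧ j = j₁ + j₂ ∧ coeffXY i₁ j₁ f ≠ 0 ∧ coeffXY i₂ j₂ g ≠ 0 := by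
  rw [coeffXY, MvPolynomial.coeff_mul] at h
  obtain ⟨⟨s, t⟩, hst, hne⟩ := Finset.exists_ne_zero_of_sum_ne_zero h
  have := expo_eq_iff.1 (Finset.HasAntidiagonal.mem_antidiagonal.1 hst).symm
  refine ⟨s 0, s 1, t 0, t 1, this.1, this.2, ?_, ?_⟩
  · rw [coeffXY, expo_self]; exact left_ne_zero_of_mul hne
  · rw [coeffXY, expo_self]; exact right_ne_zero_of_mul hne

theorem InBox.add {f g : Poly} {m n : ℕ} (hf : InBox f m n) (hg : InBox g m n) :
    InBox (f + g) m n := by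
  intro i j hij
  rw [coeffXY_add] at hij
  by_cases h : coeffXY i j f = 0
  · rw [h, zero_add] at hij; exact hg i j hij
  · exact hf i j h

theorem InBox.sub {f g : Poly} {m n : ℕ} (hf : InBox f m n) (hg : InBox g m n) :
    InBox (f - g) m n := by
  intro i j hij
  rw [coeffXY_sub] at hij
  by_cases h : coeffXY i j f = 0
  · rw [h, zero_sub, neg_ne_zero] at hij; exact hg i j hij
  · exact hf i j h

theorem InBox.mul {f g : Poly} {m n m' n' : ℕ} (hf : InBox f m n) (hg : InBox g m' n') :
    InBox (f * g) (m + m') (n + n') := by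
  intro i j hij
  obtain ⟨i₁, j₁, i₂, j₂, rfl, rfl, h1, h2⟩ := exists_of_coeffXY_mul_ne_zero hij
  exact ⟨add_le_add (hf _ _ h1).1 (hg _ _ h2).1, add_le_add (hf _ _ h1).2 (hg _ _ h2).2⟩

theorem coeffXY_C (i j : ℕ) (c : ℂ) :
    coeffXY i j (MvPolynomial.C c) = if i = 0 ∧ j = 0 then c else 0 := by
  have := coeffXY_monomial 0 c i j
  simpa using this

theorem InBox.C (c : ℂ) (m n : ℕ) : InBox (MvPolynomial.C c) m n := by
  intro i j hij
  rw [coeffXY_C] at hij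
  have := (ite_ne_right_iff.1 hij).1
  omega

theorem InBox.pow {f : Poly} {m n : ℕ} (hf : InBox f m n) (k : ℕ) :
    InBox (f ^ k) (k * m) (k * n) := by
  induction k with
  | zero => simpa using InBox.C 1 0 0
  | succ k ih => rw [pow_succ, add_mul, add_mul, one_mul, one_mul]; exact ih.mul hf

theorem InBox.mono {f : Poly} {m n m' n' : ℕ} (hf : InBox f m n) (hm : m ≤ m') (hn : n ≤ n') :
    InBox f m' n' := fun i j hij => ⟨(hf i j hij).1.trans hm, (hf i j hij).2.trans hn⟩

theorem InBox.sum {ι : Type*} {s : Finset ι} {f : ι → Poly} {m n : ℕ}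
    (h : ∀ i ∈ s, InBox (f i) m n) : InBox (∑ i ∈ s, f i) m n := by
  classical
  induction s using Finset.induction_on with
  | empty => intro i j hij; simp [coeffXY] at hij
  | insert i s hi ih =>
    rw [Finset.sum_insert hi]
    exact (h i (Finset.mem_insert_self _ _)).add
      (ih fun j hj => h j (Finset.mem_insert_of_mem hj))

theorem coeffXY_mul_corner {f g : Poly} {m n m' n' : ℕ} (hf : InBox f m n) (hg : InBox g m' n') :
    coeffXY (m + m') (n + n') (f * g) = coeffXY m n f * coeffXY m' n' g := by
  have hd : ∀ {f : Poly} {m n : ℕ}, InBox f m n → (xCoeff f m).natDegree ≤ n := by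
    intro f m n hf
    rw [Polynomial.natDegree_le_iff_coeff_eq_zero]
    intro j hj
    by_contra hne
    rw [coeff_xCoeff] at hne
    exact absurd (hf m j hne).2 (not_le.2 hj)
  have h := ((hasTop_embed fun i j h => (hf i j h).1).mul
    (hasTop_embed fun i j h => (hg i j h).1)).2
  rw [← map_mul, ← Nat.cast_add] at h
  rw [← coeff_embed, h, Polynomial.coeff_mul_add_eq_of_natDegree_le (hd hf) (hd hg), coeff_xCoeff,
    coeff_xCoeff]

theorem coeffXY_pow_corner {f : Poly} {m n : ℕ} (hf : InBox f m n) (k : ℕ) :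
    coeffXY (k * m) (k * n) (f ^ k) = coeffXY m n f ^ k := by
  induction k with
  | zero =>
    have := coeffXY_C 0 0 1
    simpa using this
  | succ k ih =>
    rw [pow_succ, pow_succ, add_mul, add_mul, one_mul, one_mul, coeffXY_mul_corner (hf.pow k) hf, ih]

/-! ### The pre-generator -/

theorem exists_coeffXY_eq (c : ℕ → ℕ → ℂ) (A B : ℕ) :
    ∃ R : Poly, ∀ i j, coeffXY i j R = if i ≤ A ∧ j ≤ B then c i j else 0 := by
  refine ⟨∑ p ∈ Finset.range (A + 1) ×ˢ Finset.range (B + 1),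
    MvPolynomial.monomial (expo p.1 p.2) (c p.1 p.2), fun i j => ?_⟩
  rw [coeffXY, MvPolynomial.coeff_sum]
  have h : ∀ p : ℕ × ℕ, MvPolynomial.coeff (expo i j)
      (MvPolynomial.monomial (expo p.1 p.2) (c p.1 p.2)) = if p = (i, j) then c i j else 0 := by
    rintro ⟨p, q⟩
    rw [MvPolynomial.coeff_monomial]
    by_cases hp : p = i ∧ q = j
    · rw [if_pos (by rw [hp.1, hp.2]), if_pos (by rw [hp.1, hp.2]), hp.1, hp.2]
    · rw [if_neg, if_neg]
      · simpa using hp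
      · intro he
        have := expo_eq_iff.1 he
        simp only [expo, Finsupp.add_apply, Finsupp.single_apply] at this
        simp at this
        exact hp this
  simp only [h]
  rw [Finset.sum_ite_eq' _ (i, j)]
  simp

/-- The cofactor of `f - g` in `f ^ (e + 1) - g ^ (e + 1)`. -/
noncomputable def cofactor (e : ℕ) (f g : Poly) : Poly :=
  ∑ l ∈ Finset.range (e + 1), f ^ l * g ^ (e - l)

theorem cofactor_mul (e : ℕ) (f g : Poly) :
    cofactor e f g * (f - g) = f ^ (e + 1) - g ^ (e + 1) :=
  Commute.geom_sum₂_mul (Commute.all f g) (e + 1)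

theorem inBox_cofactor {e A B : ℕ} {f g : Poly} (hf : InBox f A B) (hg : InBox g A B) :
    InBox (cofactor e f g) (e * A) (e * B) := by
  refine InBox.sum fun l hl => ?_
  have hl' : l + (e - l) = e := by have := Finset.mem_range.1 hl; omega
  have := (hf.pow l).mul (hg.pow (e - l))
  rwa [← add_mul, ← add_mul, hl'] at this

theorem coeffXY_cofactor {e A B : ℕ} {f g : Poly} (hf : InBox f A B) (hg : InBox g A B)
    (hfc : coeffXY A B f = 1) (hgc : coeffXY A B g = 1) :
    coeffXY (e * A) (e * B) (cofactor e f g) = e + 1 := by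
  rw [cofactor, coeffXY, MvPolynomial.coeff_sum, Finset.sum_congr rfl (g := fun _ => (1 : ℂ))]
  · simp
  · intro l hl
    have hl' : l + (e - l) = e := by have := Finset.mem_range.1 hl; omega
    have := coeffXY_mul_corner (hf.pow l) (hg.pow (e - l))
    rw [← add_mul, ← add_mul, hl', coeffXY_pow_corner hf, coeffXY_pow_corner hg, hfc, hgc, one_pow,
      one_pow, one_mul] at this
    exact this

/-- An approximate `a`-th root at the upper right corner. Its coefficients are determined
successively, in the order of decreasing total degree. -/
theorem exists_pow_offCorner {a A B : ℕ} (ha : 0 < a) {F : Poly} (hF : InBox F (a * A) (a * B))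
    (hc : coeffXY (a * A) (a * B) F = 1) :
    ∃ Q, InBox Q A B ∧ coeffXY A B Q = 1 ∧ OffCorner a A B (F - Q ^ a) := by
  obtain ⟨e, rfl⟩ : ∃ e, a = e + 1 := ⟨a - 1, by omega⟩
  have key : ∀ k : ℕ, ∃ Q, InBox Q A B ∧ coeffXY A B Q = 1 ∧ ∀ i j,
      coeffXY i j (F - Q ^ (e + 1)) ≠ 0 → e * A ≤ i → e * B ≤ j →
        i + j + k < (e + 1) * A + (e + 1) * B := by
    intro k
    induction k with
    | zero =>
      have hbox : InBox (MvPolynomial.monomial (expo A B) (1 : ℂ)) A B := by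
        intro i j hij
        rw [coeffXY_monomial] at hij
        have := (ite_ne_right_iff.1 hij).1
        simp only [expo, Finsupp.add_apply, Finsupp.single_apply] at this
        simp at this
        exact ⟨this.1.le, this.2.le⟩
      have hone : coeffXY A B (MvPolynomial.monomial (expo A B) (1 : ℂ)) = 1 := by
        rw [coeffXY, MvPolynomial.coeff_monomial, if_pos rfl]
      refine ⟨MvPolynomial.monomial (expo A B) 1, hbox, hone, fun i j hij _ _ => ?_⟩
      have h1 := (hF.sub (hbox.pow (e + 1))) i j hij
      by_contra hlt
      have h2 : i = (e + 1) * A := by omega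
      have h3 : j = (e + 1) * B := by omega
      apply hij
      rw [h2, h3, coeffXY_sub, hc, coeffXY_pow_corner hbox, hone, one_pow, sub_self]
    | succ k ih =>
      obtain ⟨Q, hQ, hQc, hQk⟩ := ih
      obtain ⟨R, hR⟩ := exists_coeffXY_eq (fun i j => if i + j + (k + 1) = A + B then
        coeffXY (i + e * A) (j + e * B) (F - Q ^ (e + 1)) / (e + 1) else 0) A B
      have hRbox : InBox R A B := by
        intro i j hij
        rw [hR] at hij
        exact (ite_ne_right_iff.1 hij).1
      have hRdeg : ∀ i j, coeffXY i j R ≠ 0 → i + j + (k + 1) = A + B := by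
        intro i j hij
        rw [hR] at hij
        exact (ite_ne_right_iff.1 (ite_ne_right_iff.1 hij).2).1
      have hRc : coeffXY A B R = 0 := by
        by_contra hne
        have := hRdeg A B hne
        omega
      have hQ' : InBox (Q + R) A B := hQ.add hRbox
      have hQ'c : coeffXY A B (Q + R) = 1 := by rw [coeffXY_add, hQc, hRc, add_zero]
      refine ⟨Q + R, hQ', hQ'c, fun i j hij hi hj => ?_⟩
      set T := cofactor e (Q + R) Q with hT
      have hTbox : InBox T (e * A) (e * B) := inBox_cofactor hQ' hQ
      have hTc : coeffXY (e * A) (e * B) T = e + 1 := coeffXY_cofactor hQ' hQ hQ'c hQc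
      have hE : F - (Q + R) ^ (e + 1) = (F - Q ^ (e + 1)) - T * R := by
        have := cofactor_mul e (Q + R) Q
        rw [← hT, add_sub_cancel_left] at this
        rw [this]; ring
      have hbox := (hF.sub (hQ'.pow (e + 1))) i j hij
      by_contra hlt
      rw [not_lt] at hlt
      obtain ⟨i', rfl⟩ := Nat.exists_eq_add_of_le' hi
      obtain ⟨j', rfl⟩ := Nat.exists_eq_add_of_le' hj
      -- only the corner of the cofactor contributes in this degree
      have hTR : coeffXY (i' + e * A) (j' + e * B) (T * R) = (e + 1) * coeffXY i' j' R := by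
        have hsplit : T * R = MvPolynomial.monomial (expo (e * A) (e * B)) ((e : ℂ) + 1) * R +
            (T - MvPolynomial.monomial (expo (e * A) (e * B)) ((e : ℂ) + 1)) * R := by ring
        have hexpo : expo (i' + e * A) (j' + e * B) = expo (e * A) (e * B) + expo i' j' := by
          rw [expo_eq_iff]
          simp [expo, add_comm]
        rw [hsplit, coeffXY_add]
        have h0 : coeffXY (i' + e * A) (j' + e * B)
            ((T - MvPolynomial.monomial (expo (e * A) (e * B)) ((e : ℂ) + 1)) * R) = 0 := by
          by_contra hne
          obtain ⟨i₁, j₁, i₂, j₂, h1, h2, h3, h4⟩ := exists_of_coeffXY_mul_ne_zero hne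
          have h5 := hRdeg _ _ h4
          have h6 : i₁ + j₁ < e * A + e * B := by
            rw [coeffXY_sub, coeffXY, coeffXY, MvPolynomial.coeff_monomial] at h3
            by_cases hcor : expo (e * A) (e * B) = expo i₁ j₁
            · rw [if_pos hcor, ← hcor] at h3
              exact absurd (sub_eq_zero.2 hTc) h3
            · rw [if_neg hcor, sub_zero] at h3
              have h7 := hTbox i₁ j₁ h3
              by_contra hge
              apply hcor
              rw [show i₁ = e * A by omega, show j₁ = e * B by omega]
          rw [add_mul, add_mul, one_mul, one_mul] at hlt
          omega
        rw [h0, add_zero, coeffXY, hexpo, MvPolynomial.coeff_monomial_mul]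
        rfl
      apply hij
      rw [hE, coeffXY_sub, hTR, hR]
      rw [add_mul, add_mul, one_mul, one_mul] at hlt hbox
      rw [if_pos ⟨by omega, by omega⟩]
      by_cases heq : i' + j' + (k + 1) = A + B
      · have he : (e : ℂ) + 1 ≠ 0 := by exact_mod_cast Nat.succ_ne_zero e
        rw [if_pos heq, mul_div_cancel₀ _ he, sub_self]
      · rw [if_neg heq, mul_zero, sub_zero]
        by_contra hne
        have := hQk _ _ hne hi hj
        rw [add_mul, add_mul, one_mul, one_mul] at this
        omega
  obtain ⟨Q, hQ, hQc, hQk⟩ := key (A + B)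
  refine ⟨Q, hQ, hQc, fun i j hij => ?_⟩
  rw [Nat.add_sub_cancel]
  by_contra hno
  push Not at hno
  have := hQk i j hij hno.1 hno.2
  rw [add_mul, add_mul, one_mul, one_mul] at this
  omega

/-- The approximate `a`-th root at the corner is unique. -/
theorem eq_of_offCorner {a A B : ℕ} (ha : 0 < a) {F Q Q' : Poly} (hQ : InBox Q A B)
    (hQ' : InBox Q' A B) (hQc : coeffXY A B Q = 1) (hQ'c : coeffXY A B Q' = 1)
    (h : OffCorner a A B (F - Q ^ a)) (h' : OffCorner a A B (F - Q' ^ a)) : Q = Q' := by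
  obtain ⟨e, rfl⟩ : ∃ e, a = e + 1 := ⟨a - 1, by omega⟩
  by_contra hne
  obtain ⟨V, ν, h1, h2, h3⟩ := exists_EN (sub_ne_zero.2 hne)
  have hT := inBox_cofactor (e := e) hQ hQ'
  have hTc := coeffXY_cofactor (e := e) hQ hQ' hQc hQ'c
  have htop := ((hasTop_embed fun i j h => (hT i j h).1).mul (hasTop_embed h2)).2
  rw [← map_mul, ← Nat.cast_add, cofactor_mul] at htop
  have hd : (xCoeff (Q - Q') V).natDegree ≤ ν := by
    rw [Polynomial.natDegree_le_iff_coeff_eq_zero]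
    intro j hj
    by_contra hne
    rw [coeff_xCoeff] at hne
    exact absurd (h3 j hne) (not_le.2 hj)
  have he : (e : ℂ) + 1 ≠ 0 := by exact_mod_cast Nat.succ_ne_zero e
  have hd' := (natDegree_xCoeff hT (by rw [hTc]; exact he)).le
  have hcoef : coeffXY (e * A + V) (e * B + ν) (Q ^ (e + 1) - Q' ^ (e + 1)) ≠ 0 := by
    rw [← coeff_embed, htop, Polynomial.coeff_mul_add_eq_of_natDegree_le hd' hd, coeff_xCoeff,
      coeff_xCoeff, hTc]
    exact mul_ne_zero he h1
  have hsplit : Q ^ (e + 1) - Q' ^ (e + 1) = (F - Q' ^ (e + 1)) - (F - Q ^ (e + 1)) := by ring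
  rw [hsplit, coeffXY_sub] at hcoef
  rw [OffCorner, Nat.add_sub_cancel] at h h'
  by_cases h0 : coeffXY (e * A + V) (e * B + ν) (F - Q ^ (e + 1)) = 0
  · rw [h0, sub_zero] at hcoef
    have := h' _ _ hcoef
    omega
  · have := h _ _ h0
    omega

/-- The right edge of the Newton polygon of the approximate root has full length, because the
coefficient of the top power of `x` in `F` is an exact `a`-th power. -/
theorem coeffXY_zero_ne_zero_of_offCorner {a b A B : ℕ} (ha : 2 ≤ a)
    (hab : Nat.Coprime a b)
    (hA : 0 < A) (hB : 0 < B) {F G Q : Poly} (hF : InBox F (a * A) (a * B))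
    (hFc : coeffXY (a * A) (a * B) F = 1) (hF0 : coeffXY (a * A) 0 F ≠ 0)
    (hG : InBox G (b * A) (b * B)) (hGc : coeffXY (b * A) (b * B) G ≠ 0) {c : ℂ}
    (hjac : jac F G = MvPolynomial.C c) (hQ : InBox Q A B) (hQc : coeffXY A B Q = 1)
    (hoff : OffCorner a A B (F - Q ^ a)) : coeffXY A 0 Q ≠ 0 := by
  have ha0 : 0 < a := by omega
  have hFne : coeffXY (a * A) (a * B) F ≠ 0 := by rw [hFc]; exact one_ne_zero
  have hQne : coeffXY A B Q ≠ 0 := by rw [hQc]; exact one_ne_zero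
  have tF := hasTop_embed fun i j h => (hF i j h).1
  have tG := hasTop_embed fun i j h => (hG i j h).1
  have tQ := hasTop_embed fun i j h => (hQ i j h).1
  have hbr := (tF.bracket tG).2
  have hlt : (1 : ℤ) < ((a * A : ℕ) : ℤ) + ((b * A : ℕ) : ℤ) := by
    have h1 : 2 * 1 ≤ a * A := Nat.mul_le_mul ha hA
    omega
  rw [bracket_embed, hjac, embed_C, mul_comm (LaurentPolynomial.T 1), coeff_monomial_mul_T,
    if_neg hlt.ne] at hbr
  have hode : (a : ℂ[X]) * (xCoeff F (a * A) * (xCoeff G (b * A)).derivative) =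
      b * ((xCoeff F (a * A)).derivative * xCoeff G (b * A)) := by
    have hA0 : (A : ℂ[X]) ≠ 0 := by exact_mod_cast hA.ne'
    apply mul_left_cancel₀ hA0
    push_cast at hbr
    linear_combination -hbr
  obtain ⟨f, z, -, hf, -⟩ := exists_common_root_of_derivative_eq ha0 hab (xCoeff_ne_zero hFne)
    (xCoeff_ne_zero hGc) hode
  have hpow : HasTop (embed (F - Q ^ a)) ((a * A : ℕ) : ℤ) (f ^ a - (xCoeff Q A) ^ a) := by
    rw [map_sub, map_pow, ← hf]
    refine tF.sub ?_
    have := tQ.pow a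
    rwa [← Nat.cast_mul] at this
  have hdegQ : (xCoeff Q A).natDegree = B := natDegree_xCoeff hQ hQne
  have hlow : (f ^ a - (xCoeff Q A) ^ a).natDegree < (a - 1) * (xCoeff Q A).natDegree := by
    have hpos : 0 < (a - 1) * B := Nat.mul_pos (by omega) hB
    rw [hdegQ, ← Nat.le_sub_one_iff_lt hpos, Polynomial.natDegree_le_iff_coeff_eq_zero]
    intro j hj
    by_contra hne
    rw [← hpow.2, coeff_embed] at hne
    have := hoff _ _ hne
    have h2 : (a - 1) * A ≤ a * A := Nat.mul_le_mul_right _ (Nat.sub_le _ _)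
    omega
  obtain ⟨t, ht, hft⟩ := eq_C_mul_of_natDegree_pow_sub_lt ha0 (xCoeff_ne_zero hQne) hlow
  intro h0
  apply hF0
  rw [← coeff_xCoeff, hf, hft, Polynomial.coeff_zero_eq_eval_zero, Polynomial.eval_pow,
    Polynomial.eval_mul, ← Polynomial.coeff_zero_eq_eval_zero (xCoeff Q A), coeff_xCoeff, h0,
    mul_zero, zero_pow ha0.ne']

/-! ### The generator -/

theorem mem_tschirnhausen_X : (Polynomial.X : ℂ[X]) ∈ tschirnhausen :=
  ⟨Polynomial.monic_X, by simp, by simp⟩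

theorem eq_X_of_mem_tschirnhausen {α : ℂ[X]} (hα : α ∈ tschirnhausen) (h : α.natDegree = 1) :
    α = Polynomial.X := by
  have h0 := hα.2.2
  rw [h] at h0
  rw [hα.1.eq_X_add_C h, h0, map_zero, add_zero]

/-- The composite `β(α)` has the same second coefficient as the power `α ^ deg β`, because `β` has
no term of degree `deg β - 1`. -/
theorem comp_mem_tschirnhausen {β α : ℂ[X]} (hβ : β ∈ tschirnhausen) (hα : α ∈ tschirnhausen) :
    β.comp α ∈ tschirnhausen := by
  have hβ0 := hβ.2.1
  have hα0 := hα.2.1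
  refine ⟨hβ.1.comp hα.1 hα0.ne', ?_, ?_⟩
  · rw [Polynomial.natDegree_comp]; exact Nat.mul_pos hβ0 hα0
  rw [Polynomial.natDegree_comp, Polynomial.comp, Polynomial.eval₂_eq_sum_range,
    Polynomial.finsetSum_coeff]
  refine Finset.sum_eq_zero fun e he => ?_
  rw [Polynomial.coeff_C_mul]
  have he' : e ≤ β.natDegree := Nat.lt_succ_iff.1 (Finset.mem_range.1 he)
  rcases he'.eq_or_lt with rfl | hlt
  · have h1 := hα.1.nextCoeff_pow β.natDegree
    rw [Polynomial.nextCoeff_of_natDegree_pos hα0, hα.2.2, smul_zero,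
      Polynomial.nextCoeff_of_natDegree_pos (by
        rw [Polynomial.natDegree_pow]; exact Nat.mul_pos hβ0 hα0), Polynomial.natDegree_pow] at h1
    rw [h1, mul_zero]
  · by_cases heq : e = β.natDegree - 1
    · rw [heq, hβ.2.2, zero_mul]
    · refine mul_eq_zero_of_right _ (Polynomial.coeff_eq_zero_of_natDegree_lt ?_)
      rw [Polynomial.natDegree_pow]
      have h2 : (e + 2) * α.natDegree ≤ β.natDegree * α.natDegree :=
        Nat.mul_le_mul_right _ (by omega)
      rw [add_mul] at h2
      omega

theorem exists_hasTop_aeval_zero {A : LPoly} {p : ℂ[X]} (hA : HasTop A 0 p) (β : ℂ[X]) :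
    ∃ q, HasTop (Polynomial.aeval A β) 0 q := by
  induction β using Polynomial.induction_on' with
  | add f g hf hg =>
    obtain ⟨q, hq⟩ := hf
    obtain ⟨r, hr⟩ := hg
    exact ⟨q + r, by rw [map_add]; exact hq.add hr⟩
  | monomial k z =>
    have h := (HasTop.C_top (Polynomial.C z)).mul (hA.pow k)
    rw [mul_zero, add_zero] at h
    exact ⟨_, by rw [Polynomial.aeval_monomial]; exact h⟩

/-- A decomposition `Q = β(W)` induces one of the coefficients of the top powers of `x`. -/
theorem exists_xCoeff_pow_eq {Q W : Poly} {β : ℂ[X]} {A j₀ : ℕ} (hA : 0 < A)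
    (hQ : ∀ i j, coeffXY i j Q ≠ 0 → i ≤ A) (hQA : coeffXY A j₀ Q ≠ 0) (hβ : β.Monic)
    (h : Q = Polynomial.aeval W β) : ∃ M, 0 < M ∧ A = β.natDegree * M ∧
      (∀ i j, coeffXY i j W ≠ 0 → i ≤ M) ∧ xCoeff W M ^ β.natDegree = xCoeff Q A := by
  by_cases hconst : ∀ i j, coeffXY i j W ≠ 0 → i ≤ 0
  · obtain ⟨q, hq⟩ := exists_hasTop_aeval_zero (hasTop_embed hconst) β
    rw [← embed_aeval, ← h] at hq
    exact absurd (le_of_hasTop hq hQA) (not_le.2 hA)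
  push Not at hconst
  obtain ⟨i, j, hij, hi⟩ := hconst
  have hW : W ≠ 0 := by
    rintro rfl
    simp [coeffXY] at hij
  obtain ⟨M, ν, h1, h2, -⟩ := exists_EN hW
  have hM : 0 < M := hi.trans_le (h2 i j hij)
  have htop := (hasTop_embed h2).aeval_monic (by exact_mod_cast hM) hβ
  rw [← embed_aeval, ← h] at htop
  have := htop.eq_of_ne_zero (hasTop_embed hQ) (pow_ne_zero _ (xCoeff_ne_zero h1))
    (xCoeff_ne_zero hQA)
  exact ⟨M, hM, by exact_mod_cast this.1.symm, h2, this.2⟩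

theorem exists_box_of_eq_aeval {Q W : Poly} {β : ℂ[X]} {A B : ℕ} (hA : 0 < A) (hB : 0 < B)
    (hQ : InBox Q A B) (hQc : coeffXY A B Q = 1) (hQA : coeffXY A 0 Q ≠ 0)
    (hQB : coeffXY 0 B Q ≠ 0) (hβ : β.Monic) (h : Q = Polynomial.aeval W β) :
    ∃ M N, 0 < M ∧ 0 < N ∧ A = β.natDegree * M ∧ B = β.natDegree * N ∧ InBox W M N ∧
      coeffXY M N W ^ β.natDegree = 1 ∧ coeffXY M 0 W ≠ 0 ∧ coeffXY 0 N W ≠ 0 := by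
  have hQne : coeffXY A B Q ≠ 0 := by rw [hQc]; exact one_ne_zero
  obtain ⟨M, hM, hAM, hWM, hxM⟩ := exists_xCoeff_pow_eq hA (fun i j h => (hQ i j h).1) hQA hβ h
  obtain ⟨N, hN, hBN, hWN, hxN⟩ := exists_xCoeff_pow_eq (Q := swapXY Q) (W := swapXY W) (j₀ := 0)
    hB (fun i j h => (hQ.swapXY i j h).1) (by rwa [coeffXY_swapXY]) hβ
    (by rw [h, swapXY_aeval])
  have hδ : β.natDegree ≠ 0 := by
    rintro h0
    rw [h0, zero_mul] at hAM
    omega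
  have hdeg : (xCoeff W M).natDegree = N := by
    have h1 := congrArg Polynomial.natDegree hxM
    rw [Polynomial.natDegree_pow, natDegree_xCoeff hQ hQne, hBN] at h1
    exact Nat.eq_of_mul_eq_mul_left (Nat.pos_of_ne_zero hδ) h1
  refine ⟨M, N, hM, hN, hAM, hBN, fun i j hij => ⟨hWM i j hij, hWN j i ?_⟩, ?_, ?_, ?_⟩
  · rwa [coeffXY_swapXY]
  · have h1 := congrArg Polynomial.leadingCoeff hxM
    rw [Polynomial.leadingCoeff_pow, Polynomial.leadingCoeff, Polynomial.leadingCoeff, hdeg,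
      natDegree_xCoeff hQ hQne, coeff_xCoeff, coeff_xCoeff, hQc] at h1
    exact h1
  · intro h0
    apply hQA
    rw [← coeff_xCoeff, ← hxM, Polynomial.coeff_zero_eq_eval_zero, Polynomial.eval_pow,
      ← Polynomial.coeff_zero_eq_eval_zero, coeff_xCoeff, h0, zero_pow hδ]
  · intro h0
    apply hQB
    rw [← coeffXY_swapXY, ← coeff_xCoeff, ← hxN, Polynomial.coeff_zero_eq_eval_zero,
      Polynomial.eval_pow, ← Polynomial.coeff_zero_eq_eval_zero, coeff_xCoeff, coeffXY_swapXY, h0,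
      zero_pow hδ]

/-- Among the decompositions `Q = β(W)` one with `β` of maximal degree has `W` principal. -/
theorem exists_principal {Q : Poly} {A B : ℕ} (hA : 0 < A) (hB : 0 < B)
    (hQ : InBox Q A B) (hQc : coeffXY A B Q = 1) (hQA : coeffXY A 0 Q ≠ 0)
    (hQB : coeffXY 0 B Q ≠ 0) :
    ∃ β ∈ tschirnhausen, ∃ M N W, 0 < M ∧ 0 < N ∧ A = β.natDegree * M ∧ B = β.natDegree * N ∧
      Q = Polynomial.aeval W β ∧ W ∈ rectPoly M N ∧ IsPrincipalPoly W := by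
  set S : Set ℕ := {d | ∃ β ∈ tschirnhausen, β.natDegree = d ∧ ∃ W, Q = Polynomial.aeval W β}
  have hbdd : BddAbove S := by
    refine ⟨A, ?_⟩
    rintro _ ⟨β, hβ, rfl, W, hW⟩
    obtain ⟨M, N, hM, -, hAM, -⟩ := exists_box_of_eq_aeval hA hB hQ hQc hQA hQB hβ.1 hW
    rw [hAM]
    exact Nat.le_mul_of_pos_right _ hM
  have hne : S.Nonempty := ⟨_, Polynomial.X, mem_tschirnhausen_X, rfl, Q, by simp⟩
  obtain ⟨β, hβ, hβS, W, hW⟩ := Nat.sSup_mem hne hbdd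
  obtain ⟨M, N, hM, hN, hAM, hBN, hWbox, hWc, hWM, hWN⟩ :=
    exists_box_of_eq_aeval hA hB hQ hQc hQA hQB hβ.1 hW
  -- divide `W` by its leading coefficient, a root of unity
  set z := coeffXY M N W with hz
  have hz0 : z ≠ 0 := by
    intro h0
    rw [h0, zero_pow hβ.2.1.ne'] at hWc
    exact zero_ne_one hWc
  have hzC : (Polynomial.C z * Polynomial.X : ℂ[X]).natDegree = 1 :=
    Polynomial.natDegree_C_mul_X z hz0
  have hdeg : (β.comp (Polynomial.C z * Polynomial.X)).natDegree = β.natDegree := by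
    rw [Polynomial.natDegree_comp, hzC, mul_one]
  have hβ₁ : β.comp (Polynomial.C z * Polynomial.X) ∈ tschirnhausen := by
    refine ⟨?_, by rw [hdeg]; exact hβ.2.1, ?_⟩
    · rw [Polynomial.Monic, Polynomial.leadingCoeff, hdeg, Polynomial.comp_C_mul_X_coeff,
        hβ.1.coeff_natDegree, hWc, one_mul]
    · rw [hdeg, Polynomial.comp_C_mul_X_coeff, hβ.2.2, zero_mul]
  have hW₁ : Q = Polynomial.aeval (MvPolynomial.C z⁻¹ * W)
      (β.comp (Polynomial.C z * Polynomial.X)) := by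
    rw [Polynomial.aeval_comp, map_mul, Polynomial.aeval_C, Polynomial.aeval_X,
      MvPolynomial.algebraMap_eq, ← mul_assoc, ← map_mul, mul_inv_cancel₀ hz0, map_one, one_mul, hW]
  refine ⟨_, hβ₁, M, N, _, hM, hN, by rw [hdeg, hAM], by rw [hdeg, hBN], hW₁, ?_, ?_⟩
  · rw [mem_rectPoly_iff hM hN]
    refine ⟨fun i j hij => ?_, ?_, ?_, ?_⟩
    · rw [coeffXY_C_mul] at hij
      exact hWbox i j (right_ne_zero_of_mul hij)
    · rw [coeffXY_C_mul, ← hz, inv_mul_cancel₀ hz0]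
    · rw [coeffXY_C_mul]; exact mul_ne_zero (inv_ne_zero hz0) hWM
    · rw [coeffXY_C_mul]; exact mul_ne_zero (inv_ne_zero hz0) hWN
  · ext V
    rw [Set.mem_singleton_iff]
    constructor
    · rintro ⟨α, hα, hV⟩
      have hmem : (β.comp (Polynomial.C z * Polynomial.X)).natDegree * α.natDegree ∈ S :=
        ⟨_, comp_mem_tschirnhausen hβ₁ hα, Polynomial.natDegree_comp, V, by
          rw [Polynomial.aeval_comp, ← hV, ← hW₁]⟩
      have hle := le_csSup hbdd hmem
      rw [hdeg, ← hβS] at hle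
      have h1 : α.natDegree = 1 := le_antisymm
        (Nat.le_of_mul_le_mul_left (hle.trans (mul_one _).ge) hβ.2.1) hα.2.1
      rw [hV, eq_X_of_mem_tschirnhausen hα h1, Polynomial.aeval_X]
    · rintro rfl
      exact ⟨Polynomial.X, mem_tschirnhausen_X, by simp⟩

/-! ### Polynomial expressions in the generator -/

/-- The constants `e j` are determined successively, in the order of decreasing `j`. -/
theorem exists_coeffXY_sub_sum_eq_zero {W : Poly} {M N : ℕ} (hM : 0 < M) (hW : InBox W M N)
    (hWc : coeffXY M N W = 1) (J : ℕ) (E : Poly) : ∃ e : ℕ → ℂ, ∀ j ∈ Finset.range J,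
      coeffXY (j * M) (j * N)
        (E - ∑ j ∈ Finset.range J, MvPolynomial.C (e j) * W ^ j) = 0 := by
  induction J generalizing E with
  | zero => exact ⟨0, by simp⟩
  | succ J ih =>
    set z := coeffXY (J * M) (J * N) E with hz
    obtain ⟨e, he⟩ := ih (E - MvPolynomial.C z * W ^ J)
    refine ⟨Function.update e J z, fun j hj => ?_⟩
    have hsum : ∑ j ∈ Finset.range J, MvPolynomial.C (Function.update e J z j) * W ^ j =
        ∑ j ∈ Finset.range J, MvPolynomial.C (e j) * W ^ j := by
      refine Finset.sum_congr rfl fun i hi => ?_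
      rw [Function.update_of_ne (Finset.mem_range.1 hi).ne]
    rw [Finset.sum_range_succ, hsum, Function.update_self, add_comm, ← sub_sub]
    rcases (Nat.lt_succ_iff.1 (Finset.mem_range.1 hj)).eq_or_lt with rfl | hlt
    · rw [coeffXY_sub, coeffXY_sub, coeffXY_C_mul, coeffXY_pow_corner hW, hWc, one_pow, mul_one,
        ← hz, sub_self, zero_sub, neg_eq_zero]
      rw [coeffXY, MvPolynomial.coeff_sum]
      refine Finset.sum_eq_zero fun i hi => ?_
      by_contra hne
      change coeffXY _ _ _ ≠ 0 at hne
      rw [coeffXY_C_mul] at hne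
      have h1 := (hW.pow i _ _ (right_ne_zero_of_mul hne)).1
      exact absurd (Nat.le_of_mul_le_mul_right h1 hM) (not_le.2 (Finset.mem_range.1 hi))
    · exact he j (Finset.mem_range.2 hlt)

/-- The innermost polynomial is obtained from `F` by subtracting a monic polynomial in `W` of degree
`aδ`. -/
theorem monic_pow_add_sum {a δ : ℕ} {β : ℂ[X]} (hβ : β.Monic)
    (hdeg : β.natDegree = δ) (e : ℕ → ℂ) :
    (β ^ a + ∑ j ∈ Finset.range ((a - 1) * δ), Polynomial.C (e j) * Polynomial.X ^ j).Monic ∧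
      (β ^ a + ∑ j ∈ Finset.range ((a - 1) * δ),
        Polynomial.C (e j) * Polynomial.X ^ j).natDegree = a * δ := by
  have hlt : (∑ j ∈ Finset.range ((a - 1) * δ), Polynomial.C (e j) * Polynomial.X ^ j).degree <
      (β ^ a).degree := by
    rw [Polynomial.degree_eq_natDegree (hβ.pow a).ne_zero, Polynomial.natDegree_pow, hdeg]
    refine (Polynomial.degree_sum_le _ _).trans_lt ?_
    rw [Finset.sup_lt_iff (WithBot.bot_lt_coe _)]
    intro j hj
    refine (Polynomial.degree_C_mul_X_pow_le _ _).trans_lt ?_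
    have h1 : (a - 1) * δ ≤ a * δ := Nat.mul_le_mul_right _ (Nat.sub_le _ _)
    exact_mod_cast (Finset.mem_range.1 hj).trans_le h1
  refine ⟨(hβ.pow a).add_of_left hlt, ?_⟩
  rw [Polynomial.natDegree_add_eq_left_of_degree_lt hlt, Polynomial.natDegree_pow, hdeg]

theorem InBox.aeval {W : Poly} {M N : ℕ} (hW : InBox W M N) (β : ℂ[X]) :
    InBox (Polynomial.aeval W β) (β.natDegree * M) (β.natDegree * N) := by
  rw [Polynomial.aeval_eq_sum_range]
  refine InBox.sum fun k hk => ?_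
  have hk' : k ≤ β.natDegree := Nat.lt_succ_iff.1 (Finset.mem_range.1 hk)
  rw [MvPolynomial.smul_eq_C_mul]
  intro i j hij
  rw [coeffXY_C_mul] at hij
  exact (hW.pow k).mono (Nat.mul_le_mul_right _ hk') (Nat.mul_le_mul_right _ hk') i j
    (right_ne_zero_of_mul hij)

theorem coeffXY_aeval_corner {W : Poly} {M N : ℕ} (hM : 0 < M) (hW : InBox W M N)
    (hWc : coeffXY M N W = 1) {β : ℂ[X]} (hβ : β.Monic) :
    coeffXY (β.natDegree * M) (β.natDegree * N) (Polynomial.aeval W β) = 1 := by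
  have h := ((hasTop_embed fun i j h => (hW i j h).1).aeval_monic (by exact_mod_cast hM) hβ).2
  rw [← embed_aeval, ← Nat.cast_mul] at h
  have hWne : coeffXY M N W ≠ 0 := by rw [hWc]; exact one_ne_zero
  have h1 := Polynomial.coeff_pow_mul_natDegree (xCoeff W M) β.natDegree
  rw [Polynomial.leadingCoeff, natDegree_xCoeff hW hWne, coeff_xCoeff, hWc, one_pow] at h1
  rw [← coeff_embed, h, h1]

/-! ### Inner and innermost polynomials -/

theorem isPreGenerator_iff {a A B : ℕ} (ha : 0 < a) {F Q : Poly}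
    (hF : augNewton F = rect (a * A) (a * B)) : IsPreGenerator a (a * A) (a * B) F Q ↔
      Q ∈ rectPoly A B ∧ InBox (F - Q ^ a) (a * A) (a * B) ∧ OffCorner a A B (F - Q ^ a) := by
  rw [← supp_subset_iff ha hF]
  constructor
  · rintro ⟨h1, h2⟩
    rw [Nat.mul_div_cancel_left _ ha, Nat.mul_div_cancel_left _ ha] at h1
    exact ⟨h1, h2⟩
  · rintro ⟨h1, h2⟩
    refine ⟨?_, h2⟩
    rwa [Nat.mul_div_cancel_left _ ha, Nat.mul_div_cancel_left _ ha]

theorem exists_isPreGenerator {a b A B : ℕ} (ha : 2 ≤ a) (hb : 0 < b) (hab : Nat.Coprime a b)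
    (hA : 0 < A) (hB : 0 < B) {F G : Poly} (hF : F ∈ rectPoly (a * A) (a * B))
    (hG : G ∈ rectPoly (b * A) (b * B)) {c : ℂ} (hjac : jac F G = MvPolynomial.C c) :
    ∃ Q, IsPreGenerator a (a * A) (a * B) F Q := by
  have ha0 : 0 < a := by omega
  obtain ⟨hFb, hFc, hFA, hFB⟩ := (mem_rectPoly_iff (Nat.mul_pos ha0 hA) (Nat.mul_pos ha0 hB)).1 hF
  obtain ⟨hGb, hGc, -⟩ := (mem_rectPoly_iff (Nat.mul_pos hb hA) (Nat.mul_pos hb hB)).1 hG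
  have hGne : coeffXY (b * A) (b * B) G ≠ 0 := by rw [hGc]; exact one_ne_zero
  obtain ⟨Q, hQ, hQc, hoff⟩ := exists_pow_offCorner ha0 hFb hFc
  refine ⟨Q, (isPreGenerator_iff ha0 hF.1).2 ⟨?_, hFb.sub (hQ.pow a), hoff⟩⟩
  rw [mem_rectPoly_iff hA hB]
  refine ⟨hQ, hQc, ?_, ?_⟩
  · exact coeffXY_zero_ne_zero_of_offCorner ha hab hA hB hFb hFc hFA hGb hGne hjac hQ hQc hoff
  · rw [← coeffXY_swapXY]
    refine coeffXY_zero_ne_zero_of_offCorner (c := -c) (F := swapXY F) (G := swapXY G) ha hab hB hA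
      hFb.swapXY ?_ ?_ hGb.swapXY ?_ ?_ hQ.swapXY ?_ ?_
    · rwa [coeffXY_swapXY]
    · rwa [coeffXY_swapXY]
    · rwa [coeffXY_swapXY]
    · rw [jac_swapXY, hjac, swapXY_C, map_neg]
    · rwa [coeffXY_swapXY]
    · intro i j hij
      rw [← map_pow, ← map_sub, coeffXY_swapXY] at hij
      exact (hoff j i hij).symm

theorem exists_isInnermostPolynomial {a A B : ℕ} (ha : 0 < a) (hA : 0 < A) (hB : 0 < B)
    {F Q : Poly} (hF : augNewton F = rect (a * A) (a * B))
    (hQ : IsPreGenerator a (a * A) (a * B) F Q) :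
    ∃ Z, IsInnermostPolynomial a (a * A) (a * B) F Z := by
  obtain ⟨hQr, -⟩ := (isPreGenerator_iff ha hF).1 hQ
  obtain ⟨hQb, hQc, hQA, hQB⟩ := (mem_rectPoly_iff hA hB).1 hQr
  obtain ⟨β, hβ, M, N, W, hM, hN, rfl, rfl, hW, hWr, hWp⟩ := exists_principal hA hB hQb hQc hQA hQB
  obtain ⟨hWb, hWc, -⟩ := (mem_rectPoly_iff hM hN).1 hWr
  obtain ⟨e, he⟩ := exists_coeffXY_sub_sum_eq_zero hM hWb hWc ((a - 1) * β.natDegree) (F - Q ^ a)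
  have haδ : 0 < a * β.natDegree := Nat.mul_pos ha hβ.2.1
  have hdiv : ∀ X, a * (β.natDegree * X) / (a * β.natDegree) = X := fun X => by
    rw [← mul_assoc, Nat.mul_div_cancel_left _ haδ]
  have hdiv' : ∀ j X, j * (a * (β.natDegree * X)) / (a * β.natDegree) = j * X := fun j X => by
    rw [← mul_assoc a, mul_left_comm, Nat.mul_div_cancel_left _ haδ]
  refine ⟨_, Q, β.natDegree, β, W, e, hQ, ⟨hβ, rfl, hWp, ?_, ?_, ?_, ?_⟩, rfl, fun j hj => ?_⟩
  · rw [Nat.mul_div_cancel_left _ ha]; exact Dvd.intro _ rfl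
  · rw [Nat.mul_div_cancel_left _ ha]; exact Dvd.intro _ rfl
  · rw [hdiv, hdiv]; exact hWr
  · rw [← hW]; exact hQ.supp_subset
  · rw [hdiv', hdiv']; exact he j hj

theorem IsInnerPolynomial.vertexProperty {a b A B : ℕ} (ha : 0 < a) (hb : 0 < b)
    (hab : Nat.Coprime a b) (hA : 0 < A) (hAB : A ≤ B) {F G : Poly}
    (hF : augNewton F = rect (a * A) (a * B)) (hG : G ∈ rectPoly (b * A) (b * B)) {c : ℂ}
    (hjac : jac F G = MvPolynomial.C c) (hsize : (a : ℤ) * (B - A) ≤ a + b - 1) {ζ : Poly}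
    (hζ : IsInnerPolynomial a (a * A) (a * B) F ζ) : VertexProperty (a * A) (a * B) ζ := by
  have hB : 0 < B := hA.trans_le hAB
  obtain ⟨Q, hQ, rfl⟩ := hζ
  obtain ⟨hQr, hbox, hoff⟩ := (isPreGenerator_iff ha hF).1 hQ
  obtain ⟨hQb, hQc, -⟩ := (mem_rectPoly_iff hA hB).1 hQr
  obtain ⟨hGb, hGc, -⟩ := (mem_rectPoly_iff (Nat.mul_pos hb hA) (Nat.mul_pos hb hB)).1 hG
  refine vertexProperty_of_jac (α := Polynomial.X ^ a) (W := Q) (G := G) (δ := 1) (c := c) ha hb hab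
    hA hAB (by rw [mul_one]) (by rw [mul_one]) (Polynomial.monic_X_pow a) (by simp) one_pos hQb ?_ ?_
    ?_ hbox ?_ ?_ ?_
  · rw [hQc]; exact one_ne_zero
  · rwa [mul_one]
  · rw [mul_one, hGc]; exact one_ne_zero
  · rwa [one_mul, one_mul]
  · rw [map_pow, Polynomial.aeval_X, add_sub_cancel, hjac]
  · rwa [Nat.cast_one, mul_one]

theorem IsInnermostPolynomial.vertexProperty {a b A B : ℕ} (ha : 0 < a) (hb : 0 < b)
    (hab : Nat.Coprime a b) (hA : 0 < A) (hAB : A ≤ B) {F G : Poly}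
    (hF : F ∈ rectPoly (a * A) (a * B)) (hG : G ∈ rectPoly (b * A) (b * B)) {c : ℂ}
    (hjac : jac F G = MvPolynomial.C c) (hsize : (a : ℤ) * (B - A) ≤ a + b - 1) {Z : Poly}
    (hZ : IsInnermostPolynomial a (a * A) (a * B) F Z) : VertexProperty (a * A) (a * B) Z := by
  have hB : 0 < B := hA.trans_le hAB
  obtain ⟨Q, δ, β, W, e, hQ, hW, rfl, -⟩ := hZ
  have hδ : 0 < δ := hW.natDegree_eq ▸ hW.tsch.2.1
  obtain ⟨M, hAM⟩ := hW.dvd_left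
  obtain ⟨N, hBN⟩ := hW.dvd_right
  rw [Nat.mul_div_cancel_left _ ha] at hAM hBN
  subst hAM hBN
  have hM : 0 < M := Nat.pos_of_mul_pos_left hA
  have hN : 0 < N := Nat.pos_of_mul_pos_left hB
  have hMN : M ≤ N := Nat.le_of_mul_le_mul_left hAB hδ
  have haδ : 0 < a * δ := Nat.mul_pos ha hδ
  have hWr := hW.mem
  rw [← mul_assoc, ← mul_assoc, Nat.mul_div_cancel_left _ haδ, Nat.mul_div_cancel_left _ haδ] at hWr
  obtain ⟨hWb, hWc, -⟩ := (mem_rectPoly_iff hM hN).1 hWr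
  obtain ⟨hQr, hbox, hoff⟩ := (isPreGenerator_iff ha hF.1).1 hQ
  obtain ⟨hQb, hQc, -⟩ := (mem_rectPoly_iff hA hB).1 hQr
  obtain ⟨hGb, hGc, -⟩ := (mem_rectPoly_iff (Nat.mul_pos hb hA) (Nat.mul_pos hb hB)).1 hG
  have hQW : Polynomial.aeval W β = Q := by
    have h1 := hWb.aeval β
    have h2 := coeffXY_aeval_corner hM hWb hWc hW.tsch.1
    rw [hW.natDegree_eq] at h1 h2
    exact eq_of_offCorner ha h1 hQb h2 hQc ((supp_subset_iff ha hF.1).1 hW.supp_subset).2 hoff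
  have hpow : ∀ j ∈ Finset.range ((a - 1) * δ), InBox (MvPolynomial.C (e j) * W ^ j) (j * M)
      (j * N) := by
    intro j _ i k hik
    rw [coeffXY_C_mul] at hik
    exact hWb.pow j i k (right_ne_zero_of_mul hik)
  have hlt : ∀ j ∈ Finset.range ((a - 1) * δ), j * M < (a - 1) * (δ * M) := by
    intro j hj
    rw [← mul_assoc]
    exact Nat.mul_lt_mul_of_pos_right (Finset.mem_range.1 hj) hM
  have hle : (a - 1) * δ ≤ a * δ := Nat.mul_le_mul_right _ (Nat.sub_le _ _)
  have hsum : InBox (∑ j ∈ Finset.range ((a - 1) * δ), MvPolynomial.C (e j) * W ^ j)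
      (a * (δ * M)) (a * (δ * N)) := by
    refine InBox.sum fun j hj => (hpow j hj).mono ?_ ?_
    · rw [← mul_assoc]
      exact Nat.mul_le_mul_right _ ((Finset.mem_range.1 hj).le.trans hle)
    · rw [← mul_assoc]
      exact Nat.mul_le_mul_right _ ((Finset.mem_range.1 hj).le.trans hle)
  have hoff' : OffCorner a (δ * M) (δ * N)
      (F - Q ^ a - ∑ j ∈ Finset.range ((a - 1) * δ), MvPolynomial.C (e j) * W ^ j) := by
    intro i k hik
    rw [coeffXY_sub] at hik
    by_cases h0 : coeffXY i k (F - Q ^ a) = 0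
    · rw [h0, zero_sub, neg_ne_zero, coeffXY, MvPolynomial.coeff_sum] at hik
      obtain ⟨j, hj, hne⟩ := Finset.exists_ne_zero_of_sum_ne_zero hik
      exact Or.inl ((hpow j hj i k hne).1.trans_lt (hlt j hj))
    · exact hoff i k h0
  obtain ⟨hα, hαdeg⟩ := monic_pow_add_sum (a := a) hW.tsch.1 hW.natDegree_eq e
  refine vertexProperty_of_jac (W := W) (G := G) (c := c) ha hb hab hM hMN (by ring) (by ring)
    hα hαdeg hδ hWb ?_ ?_ ?_ (hbox.sub hsum) hoff' ?_ ?_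
  · rw [hWc]; exact one_ne_zero
  · rwa [mul_assoc, mul_assoc]
  · rw [mul_assoc, mul_assoc, hGc]; exact one_ne_zero
  · rw [map_add, map_pow, hQW, map_sum]
    simp only [map_mul, map_pow, Polynomial.aeval_C, Polynomial.aeval_X, MvPolynomial.algebraMap_eq]
    rw [← hjac]
    congr 1
    ring
  · rw [mul_assoc, mul_sub]
    exact_mod_cast hsize

end JacobianPlane

theorem mainTheorem3 (a b m n : ℕ)
    (ha : 2 ≤ a) (hab : a < b) (hcop : Nat.Coprime a b)
    (hm : 0 < m) (hn : 0 < n) (ham : a ∣ m) (han : a ∣ n) (hmn : m ≤ n)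
    (hlarge : ((n : ℝ) - m) / a - 1 < (b : ℝ) / a)
    (F G : JacobianPlane.Poly)
    (hF : F ∈ JacobianPlane.rectPoly m n)
    (hG : G ∈ JacobianPlane.rectPoly (b * m / a) (b * n / a))
    (hFG : ∃ c : ℂ, JacobianPlane.jac F G = MvPolynomial.C c) :
    ((∃ Z, JacobianPlane.IsInnermostPolynomial a m n F Z) ∧
      ∀ Z, JacobianPlane.IsInnermostPolynomial a m n F Z → JacobianPlane.VertexProperty m n Z) ∧
    ((∃ ζ, JacobianPlane.IsInnerPolynomial a m n F ζ) ∧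
      ∀ ζ, JacobianPlane.IsInnerPolynomial a m n F ζ → JacobianPlane.VertexProperty m n ζ) := by
  obtain ⟨c, hjac⟩ := hFG
  obtain ⟨A, rfl⟩ := ham
  obtain ⟨B, rfl⟩ := han
  have ha0 : 0 < a := by omega
  have hb : 0 < b := by omega
  have hA : 0 < A := Nat.pos_of_mul_pos_left hm
  have hB : 0 < B := Nat.pos_of_mul_pos_left hn
  have hAB : A ≤ B := Nat.le_of_mul_le_mul_left hmn ha0
  rw [mul_left_comm, Nat.mul_div_cancel_left _ ha0, mul_left_comm, Nat.mul_div_cancel_left _ ha0]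
    at hG
  have hsize : (a : ℤ) * (B - A) ≤ a + b - 1 := by
    have ha' : (0 : ℝ) < a := by exact_mod_cast ha0
    rw [div_sub_one ha'.ne', div_lt_div_iff_of_pos_right ha'] at hlarge
    push_cast at hlarge
    have h1 : (a : ℝ) * (B - A) < a + b := by linarith
    have h2 : (a : ℤ) * (B - A) < a + b := by exact_mod_cast h1
    omega
  obtain ⟨Q, hQ⟩ := JacobianPlane.exists_isPreGenerator ha hb hcop hA hB hF hG hjac
  exact ⟨⟨JacobianPlane.exists_isInnermostPolynomial ha0 hA hB hF.1 hQ,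
    fun Z hZ => hZ.vertexProperty ha0 hb hcop hA hAB hF hG hjac hsize⟩,
    ⟨_, Q, hQ, rfl⟩, fun ζ hζ => hζ.vertexProperty ha0 hb hcop hA hAB hF.1 hG hjac hsize⟩
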